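/- Let $\rho$ be a symmetric, non-atomic probability measure on $\mathbb{R}$ with $\int e^{\kappa|\lambda|}\,d\rho(\lambda)<\infty$ for some $\kappa>0$. Put $r(z)=\int e^{-i\lambda z}\,d\rho(\lambda)$ for $|\mathrm{Im}\,z|<\kappa$ and, with $\varphi(s)=\sinh(s)/s$, $\varphi(0)=1$, let $r_\ell(x;y)=\int e^{-i\lambda x}\varphi(\lambda y)^{\ell}\,d\rho(\lambda)$ for $\ell=1,2$. Assume that for some $\kappa'\in(0,\kappa/2)$ and some $x_\star\in\mathbb{R}$, $$\sum_{j\ge k}|r(jx_\star)|+\sup_{|y|<\kappa'}\Big\{\sum_{j\ge k}|r_1'(jx_\star;2y)|+\sum_{j\ge k}|r_2''(jx_\star;y)|\Big\}\longrightarrow 0\qquad(k\to\infty),$$ where derivatives are taken in the variable $x$. Let $f$ be a centered, complex analytic, Gaussian random function on the strip $\mathbb{S}=\{z\in\mathbb{C}:|\mathrm{Im}\,z|<\kappa/2\}$ (real and imaginary parts of finitely many values are jointly Gaussian), with $\mathbb{E}[f(z)\overline{f(w)}]=r(z-\bar w)$ and $\mathbb{E}[f(z)f(w)]=r(z-w)$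 for all $z,w\in\mathbb{S}$. Put $G_j(y)=f(jx_\star+iy)$. Then for every $\zeta>0$ there is $\varepsilon_\star=\varepsilon_\star(\zeta)>0$ such that for every $0<\varepsilon\le\varepsilon_\star$ there is $k_\star=k_\star(\zeta,\varepsilon)\in\mathbb{N}$ such that for every $k\ge k_\star$, all large enough $m$ (uniformly in $y$) and all $|y|<\kappa'$, the moments $\mathbb{E}[|G_0(y)|^{\pm2\varepsilon}]$ are finite and $$\mathbb{E}\Big[\prod_{j=1}^m|G_{jk}(y)|^{\varepsilon}\Big]\le e^{2\varepsilon\zeta m}\,\mathbb{E}\big[|G_0(y)|^{2\varepsilon}\big]^{m/2},\qquad \mathbb{E}\Big[\prod_{j=1}^m|G_{jk}(y)|^{-\varepsilon}\Big]\le e^{2\varepsilon\zeta m}\,\mathbb{E}\big[|G_0(y)|^{-2\varepsilon}\big]^{m/2}.$$ -/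

import Mathlib

open MeasureTheory ProbabilityTheory Filter
open scoped ENNReal Topology

noncomputable section

/-- The function `sinh s / s`, continued by its limit `1` at `s = 0`. -/
def sinhc (s : ℝ) : ℝ := if s = 0 then 1 else Real.sinh s / s

/-- The covariance `r(z) = ∫ exp (-i l z) dρ(l)` of spectral measure `ρ`, at complex arguments. -/
def specCov (ρ : Measure ℝ) (z : ℂ) : ℂ :=
  ∫ l : ℝ, Complex.exp (-(Complex.I * (l : ℂ) * z)) ∂ρ

/-- The covariances `r_ℓ(x; y) = ∫ exp (-i l x) (sinh (l y) / (l y)) ^ ℓ dρ(l)`. -/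
def modCov (ρ : Measure ℝ) (ℓ : ℕ) (y x : ℝ) : ℂ :=
  ∫ l : ℝ, Complex.exp (-(Complex.I * (l : ℂ) * (x : ℂ))) * ((sinhc (l * y) ^ ℓ : ℝ) : ℂ) ∂ρ

/-- The tail
`ω⋆(k) = ∑_{j ≥ k} |r(j x⋆)| + sup_{|y| < κ'} (∑_{j ≥ k} |r₁'(j x⋆; 2y)| + ∑_{j ≥ k} |r₂''(j x⋆; y)|)`,
the derivatives being in the `x`-variable, with values in `[0, ∞]`. -/
def covTail (ρ : Measure ℝ) (κ' xs : ℝ) (k : ℕ) : ℝ≥0∞ :=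
  (∑' j : {j : ℕ // k ≤ j}, ‖specCov ρ (((j : ℕ) : ℝ) * xs : ℝ)‖ₑ) +
    ⨆ y ∈ Set.Ioo (-κ') κ',
      ((∑' j : {j : ℕ // k ≤ j}, ‖deriv (modCov ρ 1 (2 * y)) (((j : ℕ) : ℝ) * xs)‖ₑ) +
        ∑' j : {j : ℕ // k ≤ j}, ‖iteratedDeriv 2 (modCov ρ 2 y) (((j : ℕ) : ℝ) * xs)‖ₑ)

/-- The standing decay and regularity assumption on the spectral measure `ρ`, with its
parameters `κ`, `κ'`, `x⋆`. -/
structure SpectralRegularity (ρ : Measure ℝ) (κ κ' xs : ℝ) : Prop where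
  noAtoms : ∀ x : ℝ, ρ {x} = 0
  kappa_pos : 0 < κ
  expMoment : Integrable (fun l : ℝ => Real.exp (|l| * κ)) ρ
  kappa'_pos : 0 < κ'
  kappa'_lt : κ' < κ / 2
  tail_tendsto : Tendsto (covTail ρ κ' xs) atTop (𝓝 0)

/-- The open horizontal strip `|Im z| < a`. -/
def strip (a : ℝ) : Set ℂ := {z : ℂ | |z.im| < a}

/-- `f` is a centered, complex analytic, Gaussian random function on the strip `|Im z| < κ / 2`
with `E[f(z) conj(f(w))] = r(z - conj w)` and `E[f(z) f(w)] = r(z - w)`. Gaussian means that the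
real and imaginary parts of finitely many values are jointly (real) Gaussian. The covariances
determine the law of `f`, which is that of the analytic extension of the real stationary centered
Gaussian process of covariance `r`. -/
structure IsGaussianExtension {Ω : Type*} [MeasurableSpace Ω] (P : Measure Ω)
    (ρ : Measure ℝ) (κ : ℝ) (f : ℂ → Ω → ℂ) : Prop where
  gaussian : IsGaussianProcess (fun (z : strip (κ / 2)) => f z) P
  analytic : ∀ᵐ ω ∂P, DifferentiableOn ℂ (fun z => f z ω) (strip (κ / 2))
  mean : ∀ z ∈ strip (κ / 2), ∫ ω, f z ω ∂P = 0
  cov : ∀ z ∈ strip (κ / 2), ∀ w ∈ strip (κ / 2),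
    ∫ ω, f z ω * starRingEnd ℂ (f w ω) ∂P = specCov ρ (z - starRingEnd ℂ w)
  pseudoCov : ∀ z ∈ strip (κ / 2), ∀ w ∈ strip (κ / 2),
    ∫ ω, f z ω * f w ω ∂P = specCov ρ (z - w)

/-- The Gaussian variables `G_j(y) = f(j x⋆ + i y)`. -/
def gaussSample {Ω : Type*} (f : ℂ → Ω → ℂ) (xs : ℝ) (j : ℕ) (y : ℝ) (ω : Ω) : ℂ :=
  f ((j : ℂ) * (xs : ℂ) + Complex.I * (y : ℂ)) ω

/-- The moment `E[∏_{j=1}^m |G_{jk}(y)| ^ s]`, in `[0, ∞]`, for real `s` of either sign. -/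
def prodMoment {Ω : Type*} [MeasurableSpace Ω] (P : Measure Ω) (f : ℂ → Ω → ℂ)
    (xs : ℝ) (k m : ℕ) (y s : ℝ) : ℝ≥0∞ :=
  ∫⁻ ω, ∏ j ∈ Finset.Icc 1 m, ‖gaussSample f xs (j * k) y ω‖ₑ ^ s ∂P

/-- The moment `E[|G_0(y)| ^ s]`, in `[0, ∞]`. -/
def baseMoment {Ω : Type*} [MeasurableSpace Ω] (P : Measure Ω) (f : ℂ → Ω → ℂ)
    (xs y s : ℝ) : ℝ≥0∞ :=
  ∫⁻ ω, ‖gaussSample f xs 0 y ω‖ₑ ^ s ∂P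

end

/-! ### Comparison of finite-dimensional Gaussian measures -/

/-! Once the real and imaginary parts of the `G_{jk}` are rescaled, their covariance matrix is close
to the identity in operator norm, uniformly in `m` and `y`. A Gaussian density with such a
covariance is at most `(1 + small)^m` times an isotropic one, under which the product moment
factors.

Write `c(x) = r(x)`, `S(x) = -r₁'(x; 2y)`, `B(x) = -r₂''(x; y)`. For two points at height `y` and
horizontal distance `x`, the covariances of the parts are `c + y² B` (real-real), `y² B`
(imaginary-imaginary) and `y S` (real-imaginary); see `re_specCov`, `im_specCov`,
`integral_realParts_mul`. Dividing real parts by `√(1 + y² B(0))` and imaginary parts by `y √B(0)`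
leaves `normCov`, in which the degenerate factor `y` has cancelled. Since `B(0) ≥ ∫ l² dρ > 0`, its
off-diagonal row sums are at most a constant, independent of `y` and `m`, times `covTail` at `k`
(`sum_abs_normCov_le`), and Gershgorin puts its eigenvalues in `[1 - η, 1 + η]`.

In an eigenbasis the density comparison is one-dimensional (`multivariateGaussian_le_smul`) and
costs `(1 + η)/(1 - η)` per complex variable. Replacing variance `1 + η` by `1` costs a further `1 +
η` for any order `s ≤ 2`, of either sign. Hence the product moment is at most `((1 + η)²/(1 - η) ·
E|G_0|^s)^m`, and Cauchy-Schwarz bounds `E|G_0|^s` by `(E|G_0|^{2s})^{1/2}`. -/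

open scoped NNReal in
/-- Domination of measures passes to finite products. -/
theorem pi_le_prod_smul_pi {ι : Type*} [Fintype ι] {α : ι → Type*} [∀ i, MeasurableSpace (α i)]
    {μ ν : ∀ i, Measure (α i)} [∀ i, SigmaFinite (μ i)] [∀ i, SigmaFinite (ν i)] {c : ι → ℝ≥0}
    (h : ∀ i, μ i ≤ c i • ν i) : Measure.pi μ ≤ (∏ i, c i) • Measure.pi ν := by
  have hpi : (∏ i, c i) • Measure.pi ν = Measure.pi fun i => c i • ν i := by
    refine (Measure.pi_eq fun s _ => ?_).symm
    rw [Measure.smul_apply, Measure.pi_pi]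
    simp_rw [Measure.smul_apply, ENNReal.smul_def, smul_eq_mul, Finset.prod_mul_distrib]
    rw [ENNReal.ofNNReal_finsetProd]
  rw [hpi, Measure.le_iff]
  intro s hs
  rw [Measure.pi, Measure.pi, toMeasure_apply _ _ hs, toMeasure_apply _ _ hs]
  unfold OuterMeasure.pi
  -- The right side is the largest outer measure below the box premeasure, so comparing premeasures
  -- set by set suffices.
  refine OuterMeasure.le_boundedBy.2 (fun t => (OuterMeasure.boundedBy_le t).trans ?_) s
  exact Finset.prod_le_prod' fun i _ => h i _

/-- The density ratio at `x` is `√(w/v) exp(-x²(1/v - 1/w)/2)`, and `v ≤ w` makes the exponent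
nonpositive. -/
theorem gaussianReal_le_smul {v w : NNReal} (hv : 0 < v) (hvw : v ≤ w) :
    gaussianReal 0 v ≤ (NNReal.sqrt (w / v)) • gaussianReal 0 w := by
  have hw : 0 < w := hv.trans_le hvw
  rw [gaussianReal_of_var_ne_zero _ hv.ne', gaussianReal_of_var_ne_zero _ hw.ne',
    ENNReal.smul_def, ← withDensity_smul _ (measurable_gaussianPDF 0 w)]
  refine withDensity_mono (ae_of_all _ fun x => ?_)
  rw [Pi.smul_apply, smul_eq_mul, gaussianPDF, gaussianPDF, ← ENNReal.ofReal_coe_nnreal,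
    ← ENNReal.ofReal_mul (NNReal.coe_nonneg _)]
  refine ENNReal.ofReal_le_ofReal ?_
  have hv' : (0 : ℝ) < v := hv
  have hw' : (0 : ℝ) < w := hw
  have hvw' : (v : ℝ) ≤ w := hvw
  rw [gaussianPDFReal, gaussianPDFReal, ← mul_assoc, Real.coe_sqrt, NNReal.coe_div]
  have h1 : √((w : ℝ) / v) * (√(2 * Real.pi * w))⁻¹ = (√(2 * Real.pi * v))⁻¹ := by
    rw [← Real.sqrt_inv, ← Real.sqrt_inv, ← Real.sqrt_mul (by positivity)]
    congr 1
    field_simp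
  rw [h1]
  refine mul_le_mul_of_nonneg_left (Real.exp_le_exp.2 ?_) (by positivity)
  rw [neg_div, neg_div, neg_le_neg_iff]
  gcongr

open Matrix in
/-- A symmetric matrix acts diagonally in the coordinates of its eigenvector basis. -/
theorem dotProduct_mulVec_eq_sum_eigenvalues {ι : Type*} [Fintype ι] [DecidableEq ι]
    {S : Matrix ι ι ℝ} (hS : S.IsHermitian) (t : EuclideanSpace ℝ ι) :
    t ⬝ᵥ S *ᵥ t = ∑ i, hS.eigenvalues i * (hS.eigenvectorBasis.repr t i) ^ 2 := by
  have h1 (x y : EuclideanSpace ℝ ι) : x ⬝ᵥ S *ᵥ y = inner ℝ x (WithLp.toLp 2 (S *ᵥ y)) := by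
    rw [EuclideanSpace.inner_eq_star_dotProduct, dotProduct_comm]
    simp
  rw [h1, ← hS.eigenvectorBasis.sum_inner_mul_inner]
  refine Finset.sum_congr rfl fun i _ => ?_
  have h2 : inner ℝ (hS.eigenvectorBasis i) (WithLp.toLp 2 (S *ᵥ t)) =
      hS.eigenvalues i * inner ℝ (hS.eigenvectorBasis i) t := by
    rw [← h1, dotProduct_mulVec, ← mulVec_transpose]
    have hT : Sᵀ = S := by rw [← conjTranspose_eq_transpose_of_trivial]; exact hS
    rw [hT, hS.mulVec_eigenvectorBasis, EuclideanSpace.inner_eq_star_dotProduct]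
    simp [dotProduct_comm]
  rw [h2, real_inner_comm, OrthonormalBasis.repr_apply_apply]
  ring

/-- The law of `∑ X i • b i`, for independent centered `X i` of variance `v i` and an orthonormal
basis `b`. -/
noncomputable def diagGaussian {ι : Type*} [Fintype ι]
    (b : OrthonormalBasis ι ℝ (EuclideanSpace ℝ ι)) (v : ι → NNReal) :
    Measure (EuclideanSpace ℝ ι) :=
  ((Measure.pi fun i => gaussianReal 0 (v i)).map (WithLp.toLp 2)).map
    (b.repr.symm.toContinuousLinearEquiv : EuclideanSpace ℝ ι →L[ℝ] EuclideanSpace ℝ ι)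

theorem charFun_pi_gaussianReal {ι : Type*} [Fintype ι] (v : ι → NNReal)
    (t : EuclideanSpace ℝ ι) :
    charFun ((Measure.pi fun i => gaussianReal 0 (v i)).map (WithLp.toLp 2)) t =
      Complex.exp (-((∑ i, v i * (t i) ^ 2 : ℝ) : ℂ) / 2) := by
  rw [charFun_pi]
  simp only [charFun_gaussianReal, ← Complex.exp_sum]
  congr 1
  push_cast
  rw [← Finset.sum_neg_distrib, Finset.sum_div]
  refine Finset.sum_congr rfl fun i _ => ?_
  simp
  ring

theorem charFun_diagGaussian {ι : Type*} [Fintype ι]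
    (b : OrthonormalBasis ι ℝ (EuclideanSpace ℝ ι)) (v : ι → NNReal) (t : EuclideanSpace ℝ ι) :
    charFun (diagGaussian b v) t =
      Complex.exp (-((∑ i, v i * (b.repr t i) ^ 2 : ℝ) : ℂ) / 2) := by
  rw [← charFun_pi_gaussianReal, diagGaussian, charFun_apply, charFun_apply,
    integral_map (by fun_prop) (by fun_prop)]
  refine integral_congr_ae (ae_of_all _ fun x => ?_)
  have h : inner ℝ (b.repr.symm x) t = inner ℝ x (b.repr t) := by
    simpa using (b.repr.inner_map_map (b.repr.symm x) t).symm
  simp [h]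

theorem multivariateGaussian_eq_diagGaussian {ι : Type*} [Fintype ι] [DecidableEq ι]
    {S : Matrix ι ι ℝ} (hS : S.PosSemidef) :
    multivariateGaussian 0 S = diagGaussian hS.isHermitian.eigenvectorBasis
      fun i => (hS.isHermitian.eigenvalues i).toNNReal := by
  have : IsFiniteMeasure (diagGaussian hS.isHermitian.eigenvectorBasis
      fun i => (hS.isHermitian.eigenvalues i).toNNReal) := by
    unfold diagGaussian; infer_instance
  refine Measure.ext_of_charFun (funext fun t => ?_)
  rw [charFun_multivariateGaussian hS, charFun_diagGaussian,
    dotProduct_mulVec_eq_sum_eigenvalues hS.isHermitian]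
  congr 1
  simp only [inner_zero_right, Complex.ofReal_zero, zero_mul, zero_sub, neg_div,
    Real.coe_toNNReal _ (hS.eigenvalues_nonneg _)]

/-- Rotation invariance: with equal variances the characteristic function sees only `‖b.repr t‖ =
‖t‖`. -/
theorem diagGaussian_const {ι : Type*} [Fintype ι]
    (b : OrthonormalBasis ι ℝ (EuclideanSpace ℝ ι)) (w : NNReal) :
    diagGaussian b (fun _ => w) =
      (Measure.pi fun _ : ι => gaussianReal 0 w).map (WithLp.toLp 2) := by
  have : IsFiniteMeasure (diagGaussian b fun _ => w) := by
    unfold diagGaussian; infer_instance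
  refine Measure.ext_of_charFun (funext fun t => ?_)
  rw [charFun_diagGaussian, charFun_pi_gaussianReal, ← Finset.mul_sum, ← Finset.mul_sum,
    ← EuclideanSpace.real_norm_sq_eq, ← EuclideanSpace.real_norm_sq_eq,
    LinearIsometryEquiv.norm_map]

/-- A centered Gaussian measure whose covariance eigenvalues lie in `[u, w]` is dominated by the
isotropic one of variance `w`. -/
theorem multivariateGaussian_le_smul {ι : Type*} [Fintype ι] [DecidableEq ι]
    {S : Matrix ι ι ℝ} (hS : S.IsHermitian) {u w : NNReal} (hu : 0 < u)
    (hl : ∀ i, u ≤ hS.eigenvalues i) (hr : ∀ i, hS.eigenvalues i ≤ w) :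
    multivariateGaussian 0 S ≤ (NNReal.sqrt (w / u) ^ Fintype.card ι) •
      (Measure.pi fun _ : ι => gaussianReal 0 w).map (WithLp.toLp 2) := by
  have hu' : (0 : ℝ) < u := hu
  have hpos : S.PosSemidef :=
    hS.posSemidef_iff_eigenvalues_nonneg.2 fun i => hu'.le.trans (hl i)
  rw [multivariateGaussian_eq_diagGaussian hpos,
    ← diagGaussian_const hpos.isHermitian.eigenvectorBasis, diagGaussian, diagGaussian,
    ← Measure.map_smul, ← Measure.map_smul]
  -- Both measures are now images of product measures under the same map, so only the coordinates
  -- need comparing.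
  refine Measure.map_mono (Measure.map_mono ?_ (by fun_prop)) (by fun_prop)
  have hc : NNReal.sqrt (w / u) ^ Fintype.card ι = ∏ _i : ι, NNReal.sqrt (w / u) := by
    simp [Finset.card_univ]
  rw [hc]
  refine pi_le_prod_smul_pi fun i => ?_
  have hui : u ≤ (hS.eigenvalues i).toNNReal := NNReal.le_toNNReal_of_coe_le (hl i)
  have hwi : (hS.eigenvalues i).toNNReal ≤ w := Real.toNNReal_le_iff_le_coe.2 (hr i)
  refine (gaussianReal_le_smul (hu.trans_le hui) hwi).trans ?_
  refine Measure.le_iff.2 fun s _ => ?_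
  rw [Measure.smul_apply, Measure.smul_apply]
  have : NNReal.sqrt (w / (hS.eigenvalues i).toNNReal) ≤ NNReal.sqrt (w / u) := by
    gcongr
  exact smul_le_smul_of_nonneg_right this (by positivity)

/-- A pairing of the coordinates of an isotropic Gaussian vector. -/
theorem pi_prod_map_eq_pi {J : Type*} [Fintype J] (μ : Measure ℝ) [SigmaFinite μ] :
    (Measure.pi fun _ : J => μ.prod μ).map
      (fun z (p : J × Bool) => if p.2 then (z p.1).1 else (z p.1).2) =
      Measure.pi fun _ : J × Bool => μ := by
  refine (Measure.pi_eq fun s hs => ?_).symm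
  have hm : Measurable fun (z : J → ℝ × ℝ) (p : J × Bool) =>
      if p.2 then (z p.1).1 else (z p.1).2 := by
    refine measurable_pi_lambda _ fun p => ?_
    rcases p with ⟨j, b⟩
    cases b <;> simp <;> fun_prop
  rw [Measure.map_apply hm (.univ_pi hs)]
  have : (fun (z : J → ℝ × ℝ) (p : J × Bool) => if p.2 then (z p.1).1 else (z p.1).2) ⁻¹'
      Set.univ.pi s = Set.univ.pi fun j => s (j, true) ×ˢ s (j, false) := by
    ext z
    simp only [Set.mem_preimage, Set.mem_pi, Set.mem_univ, true_implies, Prod.forall,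
      Bool.forall_bool, Set.mem_prod]
    simp [and_comm]
  rw [this, Measure.pi_pi, Fintype.prod_prod_type]
  simp [Measure.prod_prod]

/-- Products over the coordinates integrate to products. -/
theorem lintegral_pi_prod {J : Type*} [Fintype J] {α : Type*} [MeasurableSpace α]
    (μ : Measure α) [IsProbabilityMeasure μ] {F : α → ℝ≥0∞} (hF : Measurable F) :
    ∫⁻ z, ∏ j, F (z j) ∂(Measure.pi fun _ : J => μ) = (∫⁻ a, F a ∂μ) ^ Fintype.card J := by
  have hind : iIndepFun (fun (j : J) (z : J → α) => F (z j)) (Measure.pi fun _ : J => μ) :=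
    iIndepFun_pi (X := fun _ => F) fun _ => hF.aemeasurable
  have h := lintegral_prod_eq_prod_lintegral_of_indepFun (s := Finset.univ)
    (X := fun (j : J) (z : J → α) => F (z j)) hind
    (fun j => hF.comp (measurable_pi_apply j))
  rw [h]
  have h2 (j : J) : ∫⁻ z, F (z j) ∂(Measure.pi fun _ : J => μ) = ∫⁻ a, F a ∂μ :=
    (measurePreserving_eval (fun _ : J => μ) j).lintegral_comp hF
  simp [h2, Finset.card_univ]

/-! ### Moments of Gaussian vectors with nearly diagonal covariance -/

open Matrix in
/-- A centered Gaussian vector whose covariance is a diagonal rescaling of `S` is a diagonal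
rescaling of the Gaussian vector of covariance `S`. -/
theorem map_toLp_eq_map_multivariateGaussian {Ω : Type*} [MeasurableSpace Ω] {P : Measure Ω}
    [IsProbabilityMeasure P] {ι : Type*} [Fintype ι] [DecidableEq ι] {X : ι → Ω → ℝ}
    (hX : HasGaussianLaw (fun ω i => X i ω) P) (hmean : ∀ i, ∫ ω, X i ω ∂P = 0)
    {S : Matrix ι ι ℝ} (hS : S.PosSemidef) (s : ι → ℝ)
    (hcov : ∀ i j, ∫ ω, X i ω * X j ω ∂P = s i * S i j * s j) :
    P.map (fun ω => WithLp.toLp 2 fun i => X i ω) =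
      (multivariateGaussian 0 S).map (fun x => WithLp.toLp 2 fun i => s i * x i) := by
  have hXi (i : ι) : HasGaussianLaw (X i) P := hX.eval i
  have hmem (i : ι) : MemLp (X i) 2 P := (hXi i).memLp_two
  have hL : HasGaussianLaw (fun ω => WithLp.toLp 2 fun i => X i ω) P := hX.toLp_pi 2
  have hG : IsGaussian (P.map fun ω => WithLp.toLp 2 fun i => X i ω) := hL.isGaussian_map
  have hsm : Measurable fun x : EuclideanSpace ℝ ι => WithLp.toLp 2 fun i => s i * x i := by
    fun_prop
  refine Measure.ext_of_charFun (funext fun t => ?_)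
  have hm0 : ∫ x, id x ∂(P.map fun ω => WithLp.toLp 2 fun i => X i ω) = 0 := by
    rw [integral_map hL.aemeasurable (by fun_prop)]
    ext i
    have hint : Integrable (fun ω => WithLp.toLp 2 fun i => X i ω) P := hL.integrable
    have := (EuclideanSpace.proj (𝕜 := ℝ) i).integral_comp_comm hint
    simp only [id]
    refine (this.symm.trans ?_)
    simpa using hmean i
  have hleft := IsGaussian.charFun_eq' (μ := P.map fun ω => WithLp.toLp 2 fun i => X i ω) t
  rw [hleft, hm0, covarianceBilin_apply_pi hmem]
  -- The rescaling is moved onto `t`, so no `s i` is inverted; for `y = 0` the scale of the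
  -- imaginary parts is `0`.
  have hright : charFun ((multivariateGaussian 0 S).map
      (fun x => WithLp.toLp 2 fun i => s i * x i)) t =
      charFun (multivariateGaussian 0 S) (WithLp.toLp 2 fun i => s i * t i) := by
    rw [charFun_apply, charFun_apply, integral_map hsm.aemeasurable (by fun_prop)]
    refine integral_congr_ae (ae_of_all _ fun x => ?_)
    simp only [PiLp.inner_apply, RCLike.inner_apply, conj_trivial]
    congr 3
    exact Finset.sum_congr rfl fun i _ => by ring
  rw [hright, charFun_multivariateGaussian hS]
  congr 1
  simp only [inner_zero_right, Complex.ofReal_zero, zero_mul, zero_sub]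
  congr 3
  simp only [dotProduct, mulVec, Finset.mul_sum]
  refine Finset.sum_congr rfl fun i _ => Finset.sum_congr rfl fun j _ => ?_
  rw [covariance_eq_sub (hmem i) (hmem j), hmean i, hmean j]
  have := hcov i j
  simp only [Pi.mul_apply]
  rw [this]
  ring

/-- The power `|α a + i β b| ^ s` of a rescaled point of the plane. -/
noncomputable def ellipticPow (α β s : ℝ) (z : ℝ × ℝ) : ℝ≥0∞ :=
  ‖(⟨α * z.1, β * z.2⟩ : ℂ)‖ₑ ^ s

/-- The moment of order `s` of `α Z + i β Z'` for independent standard normal `Z`, `Z'`. -/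
noncomputable def ellipticMoment (α β s : ℝ) : ℝ≥0∞ :=
  ∫⁻ z, ellipticPow α β s z ∂(gaussianReal 0 1).prod (gaussianReal 0 1)

theorem measurable_complex_mk {X : Type*} [MeasurableSpace X] {u v : X → ℝ} (hu : Measurable u)
    (hv : Measurable v) : Measurable fun x => (⟨u x, v x⟩ : ℂ) :=
  Complex.measurableEquivRealProd.symm.measurable.comp (hu.prodMk hv)

theorem measurable_ellipticPow (α β s : ℝ) : Measurable (ellipticPow α β s) :=
  (measurable_complex_mk (by fun_prop) (by fun_prop)).enorm.pow_const s

theorem measurable_prod_ellipticPow {J : Type*} [Fintype J] (α β s : ℝ) :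
    Measurable fun x : EuclideanSpace ℝ (J × Bool) =>
      ∏ j, ellipticPow α β s (x (j, true), x (j, false)) :=
  Finset.measurable_fun_prod _ fun j _ => (measurable_ellipticPow α β s).comp (by fun_prop)

theorem ennreal_rpow_le_rpow_of_nonpos {x y : ℝ≥0∞} {s : ℝ} (hs : s ≤ 0) (h : x ≤ y) :
    y ^ s ≤ x ^ s := by
  rw [← neg_neg s, ENNReal.rpow_neg, ENNReal.rpow_neg x, ENNReal.inv_le_inv]
  exact ENNReal.rpow_le_rpow h (by linarith)

/-- Scaling the plane by `√w ≥ 1` costs at most a factor `w` for moments of order `s ≤ 2`. -/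
theorem ellipticPow_smul_le {α β s w : ℝ} (hw : 1 ≤ w) (hs : s ≤ 2) (z : ℝ × ℝ) :
    ellipticPow α β s (√w * z.1, √w * z.2) ≤ ENNReal.ofReal w * ellipticPow α β s z := by
  have hw0 : 0 ≤ w := zero_le_one.trans hw
  have h1 : (⟨α * (√w * z.1), β * (√w * z.2)⟩ : ℂ) = (√w : ℂ) * ⟨α * z.1, β * z.2⟩ := by
    apply Complex.ext <;> simp <;> ring
  have h2 : ‖(√w : ℂ)‖ₑ = ENNReal.ofReal (√w) := by
    rw [← ofReal_norm, Complex.norm_real, Real.norm_of_nonneg (Real.sqrt_nonneg w)]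
  have hsq : 1 ≤ √w := Real.one_le_sqrt.2 hw
  unfold ellipticPow
  rw [h1, enorm_mul, h2]
  generalize ‖(⟨α * z.1, β * z.2⟩ : ℂ)‖ₑ = x
  rcases le_total 0 s with h | h
  · rw [ENNReal.mul_rpow_of_nonneg _ _ h]
    gcongr
    rw [ENNReal.ofReal_rpow_of_nonneg (Real.sqrt_nonneg w) h]
    refine ENNReal.ofReal_le_ofReal ((Real.rpow_le_rpow_of_exponent_le hsq hs).trans ?_)
    simp [Real.sq_sqrt hw0]
  -- Enlarging the base decreases a nonpositive power, so the factor `1 ≤ w` is enough.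
  · calc (ENNReal.ofReal (√w) * x) ^ s ≤ x ^ s := by
          refine ennreal_rpow_le_rpow_of_nonpos h ?_
          calc x = 1 * x := (one_mul x).symm
            _ ≤ _ := by gcongr; exact ENNReal.one_le_ofReal.2 hsq
      _ = 1 * x ^ s := (one_mul _).symm
      _ ≤ _ := by gcongr; exact ENNReal.one_le_ofReal.2 hw

theorem gaussianReal_eq_map_sqrt_mul (w : NNReal) :
    gaussianReal 0 w = (gaussianReal 0 1).map (√(w : ℝ) * ·) := by
  rw [gaussianReal_map_const_mul, mul_zero]
  congr 1
  ext
  simp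

theorem lintegral_ellipticPow_gaussianReal_le {α β s : ℝ} {w : NNReal} (hw : 1 ≤ w) (hs : s ≤ 2) :
    ∫⁻ z, ellipticPow α β s z ∂(gaussianReal 0 w).prod (gaussianReal 0 w) ≤
      w * ellipticMoment α β s := by
  have hm : Measurable fun x : ℝ => √(w : ℝ) * x := by fun_prop
  rw [gaussianReal_eq_map_sqrt_mul w, Measure.map_prod_map _ _ hm hm,
    lintegral_map (measurable_ellipticPow α β s) (by fun_prop), ellipticMoment,
    ← lintegral_const_mul _ (measurable_ellipticPow α β s)]
  refine lintegral_mono fun z => ?_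
  have := ellipticPow_smul_le (α := α) (β := β) (s := s) (w := w) (by exact_mod_cast hw) hs z
  simpa [Prod.map] using this

theorem lintegral_prod_ellipticPow_pi {J : Type*} [Fintype J] (α β s : ℝ) (w : NNReal) :
    ∫⁻ x, ∏ j, ellipticPow α β s (x (j, true), x (j, false))
      ∂((Measure.pi fun _ : J × Bool => gaussianReal 0 w).map (WithLp.toLp 2)) =
      (∫⁻ z, ellipticPow α β s z ∂(gaussianReal 0 w).prod (gaussianReal 0 w)) ^
        Fintype.card J := by
  rw [lintegral_map (measurable_prod_ellipticPow α β s) (by fun_prop), ← pi_prod_map_eq_pi,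
    lintegral_map]
  · rw [← lintegral_pi_prod _ (measurable_ellipticPow α β s)]
    simp
  · exact (measurable_prod_ellipticPow α β s).comp (WithLp.measurable_toLp 2 _)
  · refine measurable_pi_lambda _ fun p => ?_
    rcases p with ⟨j, b⟩
    cases b <;> simp <;> fun_prop

section

variable {Ω : Type*} [MeasurableSpace Ω] {P : Measure Ω} [IsProbabilityMeasure P]
  {J : Type*} [Fintype J] [DecidableEq J] {G : J → Ω → ℂ}

/-- The real and imaginary parts of a finite family of complex random variables. -/
def realParts (G : J → Ω → ℂ) (p : J × Bool) (ω : Ω) : ℝ :=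
  if p.2 then (G p.1 ω).re else (G p.1 ω).im

/-- Keeping the scales `α`, `β` outside `S` lets `S` stay near the identity even when `β` is small
or zero. -/
theorem lintegral_prod_enorm_rpow_eq (hG : HasGaussianLaw (fun ω p => realParts G p ω) P)
    (hmean : ∀ p, ∫ ω, realParts G p ω ∂P = 0) {S : Matrix (J × Bool) (J × Bool) ℝ}
    (hS : S.PosSemidef) (α β : ℝ)
    (hcov : ∀ p q, ∫ ω, realParts G p ω * realParts G q ω ∂P =
      (if p.2 then α else β) * S p q * (if q.2 then α else β)) (s : ℝ) :
    ∫⁻ ω, ∏ j, ‖G j ω‖ₑ ^ s ∂P =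
      ∫⁻ x, ∏ j, ellipticPow α β s (x (j, true), x (j, false)) ∂(multivariateGaussian 0 S) := by
  have h := map_toLp_eq_map_multivariateGaussian hG hmean hS (fun p => if p.2 then α else β) hcov
  have hL : HasGaussianLaw (fun ω => WithLp.toLp 2 fun p => realParts G p ω) P := hG.toLp_pi 2
  have hsm : Measurable fun x : EuclideanSpace ℝ (J × Bool) =>
      WithLp.toLp 2 fun i : J × Bool => (if i.2 then α else β) * x i := by
    fun_prop
  calc ∫⁻ ω, ∏ j, ‖G j ω‖ₑ ^ s ∂P
      = ∫⁻ x, ∏ j, ellipticPow 1 1 s (x (j, true), x (j, false))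
          ∂(P.map fun ω => WithLp.toLp 2 fun p => realParts G p ω) := by
        rw [lintegral_map' (measurable_prod_ellipticPow 1 1 s).aemeasurable hL.aemeasurable]
        simp [ellipticPow, realParts]
    _ = _ := by
        rw [h, lintegral_map (measurable_prod_ellipticPow 1 1 s) hsm]
        simp [ellipticPow]

/-- Product moments of a complex Gaussian vector whose covariance is, up to a rescaling of the real
and of the imaginary parts, close to the identity. -/
theorem lintegral_prod_enorm_rpow_le (hG : HasGaussianLaw (fun ω p => realParts G p ω) P)
    (hmean : ∀ p, ∫ ω, realParts G p ω ∂P = 0) {S : Matrix (J × Bool) (J × Bool) ℝ}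
    (hS : S.IsHermitian) (α β : ℝ)
    (hcov : ∀ p q, ∫ ω, realParts G p ω * realParts G q ω ∂P =
      (if p.2 then α else β) * S p q * (if q.2 then α else β))
    {u w : NNReal} (hu : 0 < u) (hw : 1 ≤ w) (hl : ∀ i, u ≤ hS.eigenvalues i)
    (hr : ∀ i, hS.eigenvalues i ≤ w) {s : ℝ} (hs : s ≤ 2) :
    ∫⁻ ω, ∏ j, ‖G j ω‖ₑ ^ s ∂P ≤
      ((w / u * w : NNReal) * ellipticMoment α β s) ^ Fintype.card J := by
  have hu' : (0 : ℝ) < u := hu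
  have hpos : S.PosSemidef :=
    hS.posSemidef_iff_eigenvalues_nonneg.2 fun i => hu'.le.trans (hl i)
  rw [lintegral_prod_enorm_rpow_eq hG hmean hpos α β hcov s]
  -- Two real coordinates per complex variable turn the square roots into full factors `w / u`.
  have hcard : NNReal.sqrt (w / u) ^ Fintype.card (J × Bool) = (w / u) ^ Fintype.card J := by
    rw [Fintype.card_prod, Fintype.card_bool, mul_comm, pow_mul, NNReal.sq_sqrt]
  refine (lintegral_mono' (multivariateGaussian_le_smul hS hu hl hr) le_rfl).trans ?_
  rw [hcard, lintegral_smul_measure, lintegral_prod_ellipticPow_pi, ENNReal.smul_def, smul_eq_mul,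
    ENNReal.coe_pow, ← mul_pow, ENNReal.coe_mul, mul_assoc]
  gcongr
  exact lintegral_ellipticPow_gaussianReal_le hw hs

end

/-- Moments of a single complex Gaussian variable with independent real and imaginary part. -/
theorem lintegral_enorm_rpow_eq_ellipticMoment {Ω : Type*} [MeasurableSpace Ω] {P : Measure Ω}
    [IsProbabilityMeasure P] {G : Unit → Ω → ℂ}
    (hG : HasGaussianLaw (fun ω p => realParts G p ω) P)
    (hmean : ∀ p, ∫ ω, realParts G p ω ∂P = 0) (α β : ℝ)
    (hcov : ∀ p q, ∫ ω, realParts G p ω * realParts G q ω ∂P =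
      (if p.2 then α else β) * (1 : Matrix (Unit × Bool) (Unit × Bool) ℝ) p q *
        (if q.2 then α else β)) (s : ℝ) :
    ∫⁻ ω, ‖G () ω‖ₑ ^ s ∂P = ellipticMoment α β s := by
  have h := lintegral_prod_enorm_rpow_eq hG hmean Matrix.PosSemidef.one α β hcov s
  rw [multivariateGaussian_zero_one, ← map_pi_eq_stdGaussian, lintegral_prod_ellipticPow_pi] at h
  simpa [ellipticMoment] using h

/-- Lyapunov's inequality between the moments of order `s` and `2 s`. -/
theorem ellipticMoment_le_rpow_half (α β s : ℝ) :
    ellipticMoment α β s ≤ ellipticMoment α β (2 * s) ^ (1 / 2 : ℝ) := by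
  have h := ENNReal.lintegral_mul_le_Lp_mul_Lq ((gaussianReal 0 1).prod (gaussianReal 0 1))
    (p := 2) (q := 2) (Real.holderConjugate_iff.2 ⟨by norm_num, by norm_num⟩)
    (measurable_ellipticPow α β s).aemeasurable (aemeasurable_const (b := 1))
  have h2 (z : ℝ × ℝ) : ellipticPow α β s z ^ (2 : ℝ) = ellipticPow α β (2 * s) z := by
    rw [ellipticPow, ellipticPow, ← ENNReal.rpow_mul, mul_comm s 2]
  simpa [h2, ellipticMoment] using h

/-! ### Finiteness of the one-point moments. -/

/-- Since `x^s ≤ 1 + x²` for `0 ≤ s ≤ 2`, second moments suffice. -/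
theorem ellipticMoment_lt_top_of_nonneg (α β : ℝ) {s : ℝ} (hs : 0 ≤ s) (hs2 : s ≤ 2) :
    ellipticMoment α β s < ∞ := by
  have hfin (c : ℝ) : ∫⁻ x, ‖c * x‖ₑ ^ (2 : ℝ) ∂gaussianReal 0 1 < ∞ := by
    have h : MemLp (fun x : ℝ => c * id x) 2 (gaussianReal 0 1) :=
      IsGaussian.memLp_two_id.const_mul c
    have := lintegral_rpow_enorm_lt_top_of_eLpNorm_lt_top two_ne_zero ENNReal.ofNat_ne_top h.2
    simpa using this
  have hle (z : ℝ × ℝ) : ellipticPow α β s z ≤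
      1 + (‖α * z.1‖ₑ ^ (2 : ℝ) + ‖β * z.2‖ₑ ^ (2 : ℝ)) := by
    have h1 (x : ℝ≥0∞) : x ^ s ≤ 1 + x ^ (2 : ℝ) := by
      rcases le_total x 1 with h | h
      · exact (ENNReal.rpow_le_one h hs).trans le_self_add
      · exact (ENNReal.rpow_le_rpow_of_exponent_le h hs2).trans le_add_self
    refine (h1 _).trans (add_le_add le_rfl (le_of_eq ?_))
    rw [← ofReal_norm, ← ofReal_norm, ← ofReal_norm,
      ENNReal.ofReal_rpow_of_nonneg (norm_nonneg _) zero_le_two,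
      ENNReal.ofReal_rpow_of_nonneg (norm_nonneg _) zero_le_two,
      ENNReal.ofReal_rpow_of_nonneg (norm_nonneg _) zero_le_two,
      ← ENNReal.ofReal_add (by positivity) (by positivity)]
    congr 1
    simp only [Real.rpow_two, Complex.sq_norm, Complex.normSq_mk, Real.norm_eq_abs, sq_abs]
    ring
  refine (lintegral_mono hle).trans_lt ?_
  rw [lintegral_add_left (by fun_prop), lintegral_add_left (by fun_prop),
    lintegral_prod (fun z : ℝ × ℝ => ‖α * z.1‖ₑ ^ (2 : ℝ)) (by fun_prop),
    lintegral_prod (fun z : ℝ × ℝ => ‖β * z.2‖ₑ ^ (2 : ℝ)) (by fun_prop)]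
  simp only [lintegral_const, measure_univ, mul_one]
  exact ENNReal.add_lt_top.2 ⟨ENNReal.one_lt_top, ENNReal.add_lt_top.2 ⟨hfin α, hfin β⟩⟩

theorem integrable_abs_rpow_mul_exp {s : ℝ} (hs : -1 < s) :
    Integrable fun x : ℝ => |x| ^ s * Real.exp (-(1 / 2) * x ^ 2) := by
  have h : IntegrableOn (fun x : ℝ => |x| ^ s * Real.exp (-(1 / 2) * x ^ 2)) (Set.Ioi 0) := by
    refine (integrableOn_rpow_mul_exp_neg_mul_sq (b := 1 / 2) (by norm_num) hs).congr_fun (fun x hx => ?_)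
      measurableSet_Ioi
    simp only [abs_of_pos (Set.mem_Ioi.1 hx)]
  rw [← integrableOn_univ, ← Set.Iio_union_Ici (a := (0 : ℝ)), integrableOn_union,
    integrableOn_Ici_iff_integrableOn_Ioi]
  refine ⟨?_, h⟩
  rw [← (Measure.measurePreserving_neg (volume : Measure ℝ)).integrableOn_comp_preimage
    (Homeomorph.neg ℝ).measurableEmbedding]
  simpa [Function.comp_def] using h

theorem lintegral_gaussianReal_rpow_neg_lt_top {s : ℝ} (hs : s < 1) :
    ∫⁻ x, ‖x‖ₑ ^ (-s) ∂gaussianReal 0 1 < ∞ := by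
  have h := (integrable_abs_rpow_mul_exp (s := -s) (by linarith)).const_mul
    (√(2 * Real.pi * 1))⁻¹
  rw [gaussianReal_of_var_ne_zero _ one_ne_zero,
    lintegral_withDensity_eq_lintegral_mul _ (measurable_gaussianPDF 0 1) (by fun_prop)]
  refine lt_of_eq_of_lt (lintegral_congr_ae ?_) h.2
  have h0 : ∀ᵐ x : ℝ, x ≠ 0 := by simp [ae_iff]
  filter_upwards [h0] with x hx
  have hx' : 0 < |x| := abs_pos.2 hx
  simp only [Pi.mul_apply, gaussianPDF, gaussianPDFReal]
  have h1 : 0 ≤ (√(2 * Real.pi * 1))⁻¹ * (|x| ^ (-s) * Real.exp (-(1 / 2) * x ^ 2)) := by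
    positivity
  rw [Real.enorm_eq_ofReal h1, Real.enorm_eq_ofReal_abs,
    ENNReal.ofReal_rpow_of_pos hx', ← ENNReal.ofReal_mul (by positivity)]
  congr 1
  simp only [sub_zero, NNReal.coe_one, mul_one]
  rw [show -x ^ 2 / 2 = -(1 / 2) * x ^ 2 by ring]
  ring

/-- The modulus is at least that of the real part, which reduces the claim to a one-dimensional
negative moment. This covers `β = 0`, and is why `s < 1` is required. -/
theorem ellipticMoment_lt_top_of_neg {α : ℝ} (β : ℝ) (hα : α ≠ 0) {s : ℝ} (hs0 : 0 ≤ s)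
    (hs : s < 1) : ellipticMoment α β (-s) < ∞ := by
  have hα' : ‖α‖ₑ ^ (-s) ≠ ∞ := ENNReal.rpow_ne_top_of_ne_zero (enorm_ne_zero.2 hα) enorm_ne_top
  have hle : ∀ᵐ z ∂(gaussianReal 0 1).prod (gaussianReal 0 1),
      ellipticPow α β (-s) z ≤ ‖α‖ₑ ^ (-s) * ‖z.1‖ₑ ^ (-s) := by
    refine ae_of_all _ fun z => ?_
    rw [← ENNReal.mul_rpow_of_ne_top enorm_ne_top enorm_ne_top, ← enorm_mul]
    refine ennreal_rpow_le_rpow_of_nonpos (by linarith) ?_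
    rw [← ofReal_norm, ← ofReal_norm]
    exact ENNReal.ofReal_le_ofReal (Complex.abs_re_le_norm ⟨α * z.1, β * z.2⟩)
  refine (lintegral_mono_ae hle).trans_lt ?_
  rw [lintegral_const_mul _ (by fun_prop), lintegral_prod _ (by fun_prop)]
  simp only [lintegral_const, measure_univ, mul_one]
  exact ENNReal.mul_lt_top hα'.lt_top (lintegral_gaussianReal_rpow_neg_lt_top hs)

/-! ### Spectral integrals -/

theorem mul_sinhc (s : ℝ) : s * sinhc s = Real.sinh s := by
  unfold sinhc
  split_ifs with h
  · simp [h]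
  · field_simp

theorem sinhc_neg (s : ℝ) : sinhc (-s) = sinhc s := by
  unfold sinhc
  simp [Real.sinh_neg, neg_div_neg_eq]

theorem one_le_sinhc (s : ℝ) : 1 ≤ sinhc s := by
  wlog h : 0 ≤ s generalizing s
  · rw [← sinhc_neg]
    exact this (-s) (by linarith)
  unfold sinhc
  split_ifs with h0
  · exact le_rfl
  · have hs : 0 < s := lt_of_le_of_ne h (Ne.symm h0)
    rw [one_le_div hs]
    exact Real.self_le_sinh_iff.2 h

/-- For `s > 0`, `sinh s = e^s (1 - e^{-2s})/2 ≤ s e^s`. -/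
theorem sinhc_le_exp_abs (s : ℝ) : sinhc s ≤ Real.exp |s| := by
  wlog h : 0 ≤ s generalizing s
  · rw [← sinhc_neg, ← abs_neg]
    exact this (-s) (by linarith)
  rw [abs_of_nonneg h]
  unfold sinhc
  split_ifs with h0
  · simp [h0]
  · have hs : 0 < s := lt_of_le_of_ne h (Ne.symm h0)
    rw [div_le_iff₀ hs, Real.sinh_eq]
    have h1 : -(2 * s) + 1 ≤ Real.exp (-(2 * s)) := Real.add_one_le_exp _
    have h2 : Real.exp (-s) = Real.exp s * Real.exp (-(2 * s)) := by
      rw [← Real.exp_add]; congr 1; ring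
    rw [h2]
    nlinarith [Real.exp_pos s]

theorem measurable_sinhc : Measurable sinhc := by
  unfold sinhc
  exact Measurable.ite (measurableSet_eq_fun measurable_id measurable_const) measurable_const
    (Real.measurable_sinh.div measurable_id)

theorem norm_exp_neg_I_mul (l x : ℝ) :
    ‖Complex.exp (-(Complex.I * (l : ℂ) * (x : ℂ)))‖ = 1 := by
  rw [Complex.norm_exp]
  simp

/-- The `x`-derivative of the integrand has norm `|l g(l)|` for every `x`, which dominates. The
derivative has the same form with `-i l g` in place of `g`, so the lemma can be iterated. -/
theorem hasDerivAt_integral_exp_neg_I_mul {ρ : Measure ℝ} {g : ℝ → ℂ} (hg : Integrable g ρ)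
    (hg1 : Integrable (fun l : ℝ => (l : ℂ) * g l) ρ) (x : ℝ) :
    HasDerivAt (fun x : ℝ => ∫ l : ℝ, Complex.exp (-(Complex.I * (l : ℂ) * (x : ℂ))) * g l ∂ρ)
      (∫ l : ℝ, Complex.exp (-(Complex.I * (l : ℂ) * (x : ℂ))) *
        (-Complex.I * ((l : ℂ) * g l)) ∂ρ) x := by
  have hmeas (x : ℝ) : AEStronglyMeasurable
      (fun l : ℝ => Complex.exp (-(Complex.I * (l : ℂ) * (x : ℂ)))) ρ :=
    (by fun_prop : Continuous fun l : ℝ =>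
      Complex.exp (-(Complex.I * (l : ℂ) * (x : ℂ)))).aestronglyMeasurable
  refine (hasDerivAt_integral_of_dominated_loc_of_deriv_le (s := Set.univ)
    (bound := fun l : ℝ => ‖(l : ℂ) * g l‖)
    (F := fun (x l : ℝ) => Complex.exp (-(Complex.I * (l : ℂ) * (x : ℂ))) * g l)
    (F' := fun (x : ℝ) (l : ℝ) => Complex.exp (-(Complex.I * (l : ℂ) * (x : ℂ))) *
        (-Complex.I * ((l : ℂ) * g l))) Filter.univ_mem ?_ ?_ ?_ ?_ ?_ ?_).2
  · exact Eventually.of_forall fun x => (hmeas x).mul hg.1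
  · refine hg.norm.mono' ((hmeas x).mul hg.1) (ae_of_all _ fun l => ?_)
    rw [norm_mul, norm_exp_neg_I_mul, one_mul]
  · exact (hmeas x).mul (hg1.1.const_mul _)
  · refine ae_of_all _ fun l x _ => ?_
    rw [norm_mul, norm_exp_neg_I_mul, norm_mul]
    simp
  · exact hg1.norm
  · refine ae_of_all _ fun l x _ => ?_
    have h1 : HasDerivAt (fun x : ℝ => -(Complex.I * (l : ℂ) * (x : ℂ)))
        (-(Complex.I * (l : ℂ) * 1)) x :=
      ((Complex.ofRealCLM.hasDerivAt (x := x)).const_mul (Complex.I * (l : ℂ))).neg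
    have h2 := h1.cexp.mul_const (g l)
    simp only [mul_one, mul_assoc, neg_mul, mul_neg] at h2 ⊢
    exact h2

/-- The covariance `r` at real arguments. -/
noncomputable def covCos (ρ : Measure ℝ) (x : ℝ) : ℝ := ∫ l : ℝ, Real.cos (l * x) ∂ρ

/-- The covariance `∫ l φ(2 l y) sin (l x) dρ(l)`, which is `-r₁'(x; 2y)` for symmetric `ρ`. -/
noncomputable def covSinh (ρ : Measure ℝ) (y x : ℝ) : ℝ :=
  ∫ l : ℝ, l * sinhc (l * (2 * y)) * Real.sin (l * x) ∂ρ

/-- The covariance `∫ l ^ 2 φ(l y) ^ 2 cos (l x) dρ(l)`, which is `-r₂''(x; y)` for symmetric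
`ρ`. -/
noncomputable def covSinhSq (ρ : Measure ℝ) (y x : ℝ) : ℝ :=
  ∫ l : ℝ, l ^ 2 * sinhc (l * y) ^ 2 * Real.cos (l * x) ∂ρ

/-- Exponential moments absorb polynomial factors. -/
theorem integrable_pow_mul_of_abs_le_exp {ρ : Measure ℝ} {κ a : ℝ}
    (hκ : Integrable (fun l : ℝ => Real.exp (|l| * κ)) ρ) (ha : a < κ) (n : ℕ) {h : ℝ → ℝ}
    (hm : Measurable h) (hh : ∀ l, |h l| ≤ Real.exp (|l| * a)) :
    Integrable (fun l => l ^ n * h l) ρ := by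
  have hd : 0 < κ - a := by linarith
  refine (hκ.const_mul ((n.factorial : ℝ) / (κ - a) ^ n)).mono' (by fun_prop)
    (ae_of_all _ fun l => ?_)
  have h1 := Real.pow_div_factorial_le_exp (|l| * (κ - a)) (by positivity) n
  rw [mul_pow, div_le_iff₀ (by positivity)] at h1
  have h2 : |l| ^ n ≤ (n.factorial : ℝ) / (κ - a) ^ n * Real.exp (|l| * (κ - a)) := by
    rw [div_mul_eq_mul_div, le_div_iff₀ (by positivity)]
    linarith
  have h3 : Real.exp (|l| * κ) = Real.exp (|l| * (κ - a)) * Real.exp (|l| * a) := by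
    rw [← Real.exp_add]; congr 1; ring
  rw [Real.norm_eq_abs, abs_mul, abs_pow, h3, ← mul_assoc]
  exact mul_le_mul h2 (hh l) (abs_nonneg _) (by positivity)

theorem abs_sinhc_two_mul_le (l y : ℝ) : |sinhc (l * (2 * y))| ≤ Real.exp (|l| * (2 * |y|)) := by
  rw [abs_of_nonneg (zero_le_one.trans (one_le_sinhc _))]
  refine (sinhc_le_exp_abs _).trans (le_of_eq ?_)
  simp [abs_mul]

theorem abs_sinhc_sq_le (l y : ℝ) : |sinhc (l * y) ^ 2| ≤ Real.exp (|l| * (2 * |y|)) := by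
  have h0 := zero_le_one.trans (one_le_sinhc (l * y))
  rw [abs_of_nonneg (by positivity)]
  refine (pow_le_pow_left₀ h0 (sinhc_le_exp_abs _) 2).trans (le_of_eq ?_)
  rw [← Real.exp_nat_mul, abs_mul]
  congr 1
  push_cast
  ring

section

variable {ρ : Measure ℝ} {κ y : ℝ}

theorem integrable_pow_mul_sinhc (hκ : Integrable (fun l : ℝ => Real.exp (|l| * κ)) ρ)
    (hy : 2 * |y| < κ) (n : ℕ) : Integrable (fun l => l ^ n * sinhc (l * (2 * y))) ρ :=
  integrable_pow_mul_of_abs_le_exp hκ hy n (measurable_sinhc.comp (by fun_prop))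
    fun l => abs_sinhc_two_mul_le l y

theorem integrable_pow_mul_sinhc_sq (hκ : Integrable (fun l : ℝ => Real.exp (|l| * κ)) ρ)
    (hy : 2 * |y| < κ) (n : ℕ) : Integrable (fun l => l ^ n * sinhc (l * y) ^ 2) ρ :=
  integrable_pow_mul_of_abs_le_exp hκ hy n ((measurable_sinhc.comp (by fun_prop)).pow_const 2)
    fun l => abs_sinhc_sq_le l y

theorem MeasureTheory.Integrable.mul_cos {g : ℝ → ℝ} (hg : Integrable g ρ) (x : ℝ) :
    Integrable (fun l => g l * Real.cos (l * x)) ρ :=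
  hg.mul_bdd (c := 1) (by fun_prop : Continuous fun l : ℝ => Real.cos (l * x)).aestronglyMeasurable
    (ae_of_all _ fun l => Real.abs_cos_le_one _)

theorem MeasureTheory.Integrable.mul_sin {g : ℝ → ℝ} (hg : Integrable g ρ) (x : ℝ) :
    Integrable (fun l => g l * Real.sin (l * x)) ρ :=
  hg.mul_bdd (c := 1) (by fun_prop : Continuous fun l : ℝ => Real.sin (l * x)).aestronglyMeasurable
    (ae_of_all _ fun l => Real.abs_sin_le_one _)

theorem exp_neg_I_mul_eq (l x : ℝ) : Complex.exp (-(Complex.I * (l : ℂ) * (x : ℂ))) =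
    ⟨Real.cos (l * x), -Real.sin (l * x)⟩ := by
  have : -(Complex.I * (l : ℂ) * (x : ℂ)) = ((-(l * x) : ℝ) : ℂ) * Complex.I := by
    push_cast; ring
  rw [this]
  apply Complex.ext
  · rw [Complex.exp_ofReal_mul_I_re]; simp
  · rw [Complex.exp_ofReal_mul_I_im]; simp

theorem integrable_exp_neg_I_mul {g : ℝ → ℂ} (hg : Integrable g ρ) (x : ℝ) :
    Integrable (fun l : ℝ => Complex.exp (-(Complex.I * (l : ℂ) * (x : ℂ))) * g l) ρ :=
  hg.bdd_mul (c := 1) (by fun_prop : Continuous fun l : ℝ =>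
      Complex.exp (-(Complex.I * (l : ℂ) * (x : ℂ)))).aestronglyMeasurable
    (ae_of_all _ fun l => (norm_exp_neg_I_mul l x).le)

theorem re_integral {g : ℝ → ℂ} (hg : Integrable g ρ) :
    (∫ l, g l ∂ρ).re = ∫ l, (g l).re ∂ρ :=
  (Complex.reCLM.integral_comp_comm hg).symm

theorem im_integral {g : ℝ → ℂ} (hg : Integrable g ρ) :
    (∫ l, g l ∂ρ).im = ∫ l, (g l).im ∂ρ :=
  (Complex.imCLM.integral_comp_comm hg).symm

theorem abs_covCos_le [IsFiniteMeasure ρ] (x : ℝ) :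
    |covCos ρ x| ≤ ‖specCov ρ ((x : ℝ) : ℂ)‖ := by
  refine le_trans (le_of_eq ?_) (Complex.abs_re_le_norm _)
  have h := integrable_exp_neg_I_mul (ρ := ρ) (g := fun _ => 1) (integrable_const _) x
  simp only [mul_one] at h
  rw [specCov, re_integral h, covCos]
  simp only [exp_neg_I_mul_eq]

/-- The real part of the derivative is `-covSinh`; an upper bound by the modulus is all that is
needed, so the imaginary part need not be computed. -/
theorem abs_covSinh_le (hκ : Integrable (fun l : ℝ => Real.exp (|l| * κ)) ρ)
    (hy : 2 * |y| < κ) (x : ℝ) :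
    |covSinh ρ y x| ≤ ‖deriv (modCov ρ 1 (2 * y)) x‖ := by
  refine le_trans (le_of_eq ?_) (Complex.abs_re_le_norm _)
  have h0 : Integrable (fun l : ℝ => ((sinhc (l * (2 * y)) ^ 1 : ℝ) : ℂ)) ρ := by
    exact ((integrable_pow_mul_sinhc hκ hy 0).ofReal (𝕜 := ℂ)).congr (ae_of_all _ fun l => by simp)
  have h1 : Integrable (fun l : ℝ => (l : ℂ) * ((sinhc (l * (2 * y)) ^ 1 : ℝ) : ℂ)) ρ := by
    exact ((integrable_pow_mul_sinhc hκ hy 1).ofReal (𝕜 := ℂ)).congr (ae_of_all _ fun l => by simp)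
  have hd : deriv (modCov ρ 1 (2 * y)) x = _ := (hasDerivAt_integral_exp_neg_I_mul h0 h1 x).deriv
  rw [hd, re_integral (integrable_exp_neg_I_mul (h1.const_mul _) x), covSinh, ← abs_neg,
    ← integral_neg]
  congr 2
  funext l
  rw [exp_neg_I_mul_eq]
  simp
  ring

theorem abs_covSinhSq_le (hκ : Integrable (fun l : ℝ => Real.exp (|l| * κ)) ρ)
    (hy : 2 * |y| < κ) (x : ℝ) :
    |covSinhSq ρ y x| ≤ ‖iteratedDeriv 2 (modCov ρ 2 y) x‖ := by
  refine le_trans (le_of_eq ?_) (Complex.abs_re_le_norm _)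
  have h0 : Integrable (fun l : ℝ => ((sinhc (l * y) ^ 2 : ℝ) : ℂ)) ρ := by
    exact ((integrable_pow_mul_sinhc_sq hκ hy 0).ofReal (𝕜 := ℂ)).congr
      (ae_of_all _ fun l => by simp)
  have h1 : Integrable (fun l : ℝ => (l : ℂ) * ((sinhc (l * y) ^ 2 : ℝ) : ℂ)) ρ := by
    exact ((integrable_pow_mul_sinhc_sq hκ hy 1).ofReal (𝕜 := ℂ)).congr
      (ae_of_all _ fun l => by simp)
  have h2 : Integrable (fun l : ℝ =>
      (l : ℂ) * (-Complex.I * ((l : ℂ) * ((sinhc (l * y) ^ 2 : ℝ) : ℂ)))) ρ := by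
    have := ((integrable_pow_mul_sinhc_sq hκ hy 2).ofReal (𝕜 := ℂ)).const_mul (-Complex.I)
    refine this.congr (ae_of_all _ fun l => ?_)
    simp
    ring
  have hd : deriv (modCov ρ 2 y) = _ :=
    funext fun x => (hasDerivAt_integral_exp_neg_I_mul h0 h1 x).deriv
  rw [iteratedDeriv_succ, iteratedDeriv_one, hd,
    (hasDerivAt_integral_exp_neg_I_mul (h1.const_mul _) h2 x).deriv,
    re_integral (integrable_exp_neg_I_mul (h2.const_mul _) x), covSinhSq, ← abs_neg, ← integral_neg]
  congr 2
  funext l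
  have hI : -Complex.I * ((l : ℂ) * (-Complex.I * ((l : ℂ) * ((sinhc (l * y) ^ 2 : ℝ) : ℂ)))) =
      ((-(l ^ 2 * sinhc (l * y) ^ 2) : ℝ) : ℂ) := by
    have := Complex.I_mul_I
    push_cast
    linear_combination ((l : ℂ) ^ 2 * (sinhc (l * y) : ℂ) ^ 2) * this
  rw [exp_neg_I_mul_eq, hI, Complex.re_mul_ofReal]
  ring

/-- Symmetrization of an integral over a symmetric measure. -/
theorem integral_eq_of_add_neg [ρ.IsNegInvariant] {g h : ℝ → ℝ} (hg : Integrable g ρ)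
    (hgh : ∀ l, g l + g (-l) = 2 * h l) : ∫ l, g l ∂ρ = ∫ l, h l ∂ρ := by
  have h1 : ∫ l, g (-l) ∂ρ = ∫ l, g l ∂ρ := integral_neg_eq_self g ρ
  have h2 := integral_add hg hg.comp_neg
  rw [h1] at h2
  have h3 : ∫ l, g l + g (-l) ∂ρ = 2 * ∫ l, h l ∂ρ := by
    simp only [hgh]
    exact integral_const_mul _ _
  linarith

theorem exp_neg_I_mul_mk (l x y : ℝ) :
    Complex.exp (-(Complex.I * (l : ℂ) * (⟨x, 2 * y⟩ : ℂ))) =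
      ⟨Real.exp (l * (2 * y)) * Real.cos (l * x), -(Real.exp (l * (2 * y)) * Real.sin (l * x))⟩ := by
  apply Complex.ext
  · rw [Complex.exp_re]; simp
  · rw [Complex.exp_im]; simp

theorem integrable_exp_mul (hκ : Integrable (fun l : ℝ => Real.exp (|l| * κ)) ρ)
    (hy : 2 * |y| < κ) : Integrable (fun l => Real.exp (l * (2 * y))) ρ := by
  have := integrable_pow_mul_of_abs_le_exp hκ hy 0 (h := fun l => Real.exp (l * (2 * y)))
    (by fun_prop) fun l => by
      rw [abs_of_pos (Real.exp_pos _), Real.exp_le_exp]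
      refine (le_abs_self _).trans (le_of_eq ?_)
      simp [abs_mul]
  simpa using this

theorem integrable_exp_neg_I_mul_mk (hκ : Integrable (fun l : ℝ => Real.exp (|l| * κ)) ρ)
    (hy : 2 * |y| < κ) (x : ℝ) : Integrable (fun l : ℝ =>
      Complex.exp (-(Complex.I * (l : ℂ) * (⟨x, 2 * y⟩ : ℂ)))) ρ := by
  refine (integrable_exp_mul hκ hy).mono' (by fun_prop) (ae_of_all _ fun l => ?_)
  rw [Complex.norm_exp]
  simp

/-- Symmetry of `ρ` replaces `e^{2ly}` by `cosh(2ly) = 1 + 2 sinh²(ly)`, and `sinh(ly) = ly φ(ly)`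
produces the square of `φ`. -/
theorem re_specCov [IsFiniteMeasure ρ] [ρ.IsNegInvariant]
    (hκ : Integrable (fun l : ℝ => Real.exp (|l| * κ)) ρ) (hy : 2 * |y| < κ) (x : ℝ) :
    (specCov ρ ⟨x, 2 * y⟩).re = covCos ρ x + 2 * y ^ 2 * covSinhSq ρ y x := by
  rw [specCov, re_integral (integrable_exp_neg_I_mul_mk hκ hy x), covCos, covSinhSq,
    ← integral_const_mul, ← integral_add]
  · simp only [exp_neg_I_mul_mk]
    refine integral_eq_of_add_neg ((integrable_exp_mul hκ hy).mul_cos x) fun l => ?_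
    have h1 : Real.exp (l * (2 * y)) + Real.exp (-l * (2 * y)) = 2 * Real.cosh (2 * (l * y)) := by
      rw [Real.cosh_eq]; ring_nf
    have h2 : Real.cosh (2 * (l * y)) = 1 + 2 * (l * y * sinhc (l * y)) ^ 2 := by
      rw [mul_sinhc, Real.cosh_two_mul, Real.cosh_sq]; ring
    rw [neg_mul l x, Real.cos_neg, ← add_mul, h1, h2]
    ring
  · simpa using (integrable_const (1 : ℝ)).mul_cos (ρ := ρ) x
  · exact ((integrable_pow_mul_sinhc_sq hκ hy 2).mul_cos x).const_mul _

/-- Against the odd factor `sin(lx)` only `sinh(2ly) = 2ly φ(2ly)` survives; this is the origin of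
the argument `2y` in `r₁`. -/
theorem im_specCov [ρ.IsNegInvariant]
    (hκ : Integrable (fun l : ℝ => Real.exp (|l| * κ)) ρ) (hy : 2 * |y| < κ) (x : ℝ) :
    (specCov ρ ⟨x, 2 * y⟩).im = -(2 * y * covSinh ρ y x) := by
  rw [specCov, im_integral (integrable_exp_neg_I_mul_mk hκ hy x), covSinh,
    ← integral_const_mul, ← integral_neg]
  simp only [exp_neg_I_mul_mk]
  refine integral_eq_of_add_neg ((integrable_exp_mul hκ hy).mul_sin x).neg fun l => ?_
  have h1 : Real.exp (l * (2 * y)) - Real.exp (-l * (2 * y)) =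
      2 * (l * (2 * y) * sinhc (l * (2 * y))) := by
    rw [mul_sinhc, Real.sinh_eq]; ring_nf
  change -(Real.exp (l * (2 * y)) * Real.sin (l * x)) +
    -(Real.exp (-l * (2 * y)) * Real.sin (-l * x)) = _
  rw [neg_mul l x, Real.sin_neg]
  linear_combination -Real.sin (l * x) * h1

theorem covCos_zero [IsProbabilityMeasure ρ] : covCos ρ 0 = 1 := by simp [covCos]

theorem covSinh_zero : covSinh ρ y 0 = 0 := by simp [covSinh]

theorem covCos_neg (x : ℝ) : covCos ρ (-x) = covCos ρ x := by simp [covCos]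

theorem covSinh_neg (x : ℝ) : covSinh ρ y (-x) = -covSinh ρ y x := by
  simp only [covSinh, ← integral_neg, mul_neg, Real.sin_neg]

theorem covSinhSq_neg (x : ℝ) : covSinhSq ρ y (-x) = covSinhSq ρ y x := by simp [covSinhSq]

/-- `φ ≥ 1` gives a lower bound free of `y`, the source of uniformity in `y`. -/
theorem integral_sq_le_covSinhSq_zero (hκ : Integrable (fun l : ℝ => Real.exp (|l| * κ)) ρ)
    (hy : 2 * |y| < κ) : ∫ l, l ^ 2 ∂ρ ≤ covSinhSq ρ y 0 := by
  simp only [covSinhSq, mul_zero, Real.cos_zero, mul_one]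
  refine integral_mono_of_nonneg (ae_of_all _ fun l => sq_nonneg l)
    (integrable_pow_mul_sinhc_sq hκ hy 2) (ae_of_all _ fun l => ?_)
  exact le_mul_of_one_le_right (sq_nonneg l) (one_le_pow₀ (one_le_sinhc _))

theorem integral_sq_pos [IsProbabilityMeasure ρ]
    (hκ : Integrable (fun l : ℝ => Real.exp (|l| * κ)) ρ) (hκ0 : 0 < κ) (h0 : ρ {0} = 0) :
    0 < ∫ l, l ^ 2 ∂ρ := by
  have hint : Integrable (fun l : ℝ => l ^ 2) ρ := by
    simpa using integrable_pow_mul_of_abs_le_exp hκ hκ0 2 (h := fun _ => 1) measurable_const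
      (by simp)
  refine (integral_pos_iff_support_of_nonneg (fun l => sq_nonneg l) hint).2 ?_
  have hs : Function.support (fun l : ℝ => l ^ 2) = {0}ᶜ := by
    ext l; simp
  rw [hs, prob_compl_eq_one_sub (measurableSet_singleton 0), h0]
  simp

end

/-! ### The normalized covariance matrix -/

/-- The covariance matrix of the real and imaginary parts of `f(t j + i y)`, normalized to have
unit diagonal. -/
noncomputable def normCov {J : Type*} (ρ : Measure ℝ) (y : ℝ) (t : J → ℝ) :
    Matrix (J × Bool) (J × Bool) ℝ := fun p q =>
  if p.2 then
    if q.2 then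
      (covCos ρ (t p.1 - t q.1) + y ^ 2 * covSinhSq ρ y (t p.1 - t q.1)) /
        (1 + y ^ 2 * covSinhSq ρ y 0)
    else covSinh ρ y (t p.1 - t q.1) / (√(1 + y ^ 2 * covSinhSq ρ y 0) * √(covSinhSq ρ y 0))
  else
    if q.2 then
      covSinh ρ y (t q.1 - t p.1) / (√(1 + y ^ 2 * covSinhSq ρ y 0) * √(covSinhSq ρ y 0))
    else covSinhSq ρ y (t p.1 - t q.1) / covSinhSq ρ y 0

theorem isHermitian_normCov {J : Type*} (ρ : Measure ℝ) (y : ℝ) (t : J → ℝ) :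
    (normCov ρ y t).IsHermitian := by
  refine Matrix.IsHermitian.ext fun p q => ?_
  have h : t q.1 - t p.1 = -(t p.1 - t q.1) := by ring
  rcases p with ⟨j, _ | _⟩ <;> rcases q with ⟨l, _ | _⟩ <;>
    simp only [normCov, Bool.false_eq_true, if_true, if_false, star_trivial] <;>
    simp only [h, covCos_neg, covSinhSq_neg]

theorem normCov_diag {J : Type*} {ρ : Measure ℝ} [IsProbabilityMeasure ρ] {y : ℝ}
    (hB : 0 < covSinhSq ρ y 0) (t : J → ℝ) (p : J × Bool) : normCov ρ y t p p = 1 := by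
  have hA : 1 + y ^ 2 * covSinhSq ρ y 0 ≠ 0 := by positivity
  rcases p with ⟨j, _ | _⟩ <;> simp [normCov, covCos_zero, hB.ne', hA]

/-- `covSinh` vanishes at `0`: real and imaginary part at one point are uncorrelated. -/
theorem normCov_same_of_ne {J : Type*} (ρ : Measure ℝ) (y : ℝ) (t : J → ℝ) {p q : J × Bool}
    (h1 : p.1 = q.1) (h2 : p ≠ q) : normCov ρ y t p q = 0 := by
  rcases p with ⟨j, _ | _⟩ <;> rcases q with ⟨l, _ | _⟩ <;> simp_all [normCov, covSinh_zero]

/-- The sum of the absolute values of the basic covariances at distance `x`. -/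
noncomputable def covAbs (ρ : Measure ℝ) (y x : ℝ) : ℝ :=
  |covCos ρ x| + |covSinh ρ y x| + |covSinhSq ρ y x|

theorem covAbs_nonneg (ρ : Measure ℝ) (y x : ℝ) : 0 ≤ covAbs ρ y x := by
  unfold covAbs; positivity

theorem covAbs_neg (ρ : Measure ℝ) (y x : ℝ) : covAbs ρ y (-x) = covAbs ρ y x := by
  simp [covAbs, covCos_neg, covSinh_neg, covSinhSq_neg]

/-- The summand `1 + a²` serves the real-real entries, `b⁻¹` the imaginary-imaginary ones and
`(√b)⁻¹` the mixed ones, as the normalizers are at least `1`, `b` and `√b`. -/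
theorem abs_normCov_le {J : Type*} {ρ : Measure ℝ} {y a b : ℝ} (hb : 0 < b)
    (hB : b ≤ covSinhSq ρ y 0) (hy : |y| ≤ a) (t : J → ℝ) (p q : J × Bool) :
    |normCov ρ y t p q| ≤ (1 + a ^ 2 + b⁻¹ + (√b)⁻¹) * covAbs ρ y (t p.1 - t q.1) := by
  have hB0 : 0 < covSinhSq ρ y 0 := hb.trans_le hB
  have hsb : 0 < √b := Real.sqrt_pos.2 hb
  have hA : 1 ≤ 1 + y ^ 2 * covSinhSq ρ y 0 := by
    have : 0 ≤ y ^ 2 * covSinhSq ρ y 0 := by positivity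
    linarith
  have hy2 : y ^ 2 ≤ a ^ 2 := sq_le_sq' (by linarith [neg_abs_le y]) ((le_abs_self y).trans hy)
  have hAB : √b ≤ √(1 + y ^ 2 * covSinhSq ρ y 0) * √(covSinhSq ρ y 0) := by
    calc √b = 1 * √b := (one_mul _).symm
      _ ≤ _ := mul_le_mul (Real.one_le_sqrt.2 hA) (Real.sqrt_le_sqrt hB) hsb.le (by positivity)
  have hib : 0 < b⁻¹ := by positivity
  have hisb : 0 < (√b)⁻¹ := by positivity
  have hcross (x : ℝ) :
      |covSinh ρ y x / (√(1 + y ^ 2 * covSinhSq ρ y 0) * √(covSinhSq ρ y 0))| ≤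
        (1 + a ^ 2 + b⁻¹ + (√b)⁻¹) * covAbs ρ y x := by
    rw [abs_div, abs_of_nonneg (hsb.le.trans hAB), div_eq_mul_inv]
    calc |covSinh ρ y x| * (√(1 + y ^ 2 * covSinhSq ρ y 0) * √(covSinhSq ρ y 0))⁻¹
        ≤ covAbs ρ y x * (√b)⁻¹ := by
          refine mul_le_mul ?_ (inv_anti₀ hsb hAB) (by positivity) (covAbs_nonneg _ _ _)
          unfold covAbs
          linarith [abs_nonneg (covCos ρ x), abs_nonneg (covSinhSq ρ y x)]
      _ ≤ _ := by
          rw [mul_comm]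
          refine mul_le_mul_of_nonneg_right ?_ (covAbs_nonneg _ _ _)
          linarith [sq_nonneg a]
  rcases p with ⟨j, _ | _⟩ <;> rcases q with ⟨l, _ | _⟩ <;>
    simp only [normCov, Bool.false_eq_true, if_true, if_false]
  · generalize t j - t l = x
    rw [abs_div, abs_of_pos hB0, div_eq_mul_inv]
    calc |covSinhSq ρ y x| * (covSinhSq ρ y 0)⁻¹ ≤ covAbs ρ y x * b⁻¹ := by
          refine mul_le_mul ?_ (inv_anti₀ hb hB) (by positivity) (covAbs_nonneg _ _ _)
          unfold covAbs
          linarith [abs_nonneg (covCos ρ x), abs_nonneg (covSinh ρ y x)]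
      _ ≤ _ := by
          rw [mul_comm]
          refine mul_le_mul_of_nonneg_right ?_ (covAbs_nonneg _ _ _)
          linarith [sq_nonneg a]
  · have : t j - t l = -(t l - t j) := by ring
    rw [this, covAbs_neg]
    exact hcross _
  · exact hcross _
  · generalize t j - t l = x
    rw [abs_div, abs_of_pos (zero_lt_one.trans_le hA)]
    refine (div_le_self (abs_nonneg _) hA).trans ?_
    calc |covCos ρ x + y ^ 2 * covSinhSq ρ y x| ≤ |covCos ρ x| + y ^ 2 * |covSinhSq ρ y x| := by
          refine (abs_add_le _ _).trans (le_of_eq ?_)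
          rw [abs_mul, abs_of_nonneg (sq_nonneg y)]
      _ ≤ (1 + a ^ 2) * covAbs ρ y x := by
          unfold covAbs
          nlinarith [abs_nonneg (covCos ρ x), abs_nonneg (covSinh ρ y x),
            abs_nonneg (covSinhSq ρ y x), sq_nonneg a, mul_nonneg (sq_nonneg a)
            (abs_nonneg (covCos ρ x)), mul_nonneg (sq_nonneg a) (abs_nonneg (covSinh ρ y x)),
            mul_le_mul_of_nonneg_right hy2 (abs_nonneg (covSinhSq ρ y x))]
      _ ≤ _ := by
          refine mul_le_mul_of_nonneg_right ?_ (covAbs_nonneg _ _ _)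
          linarith

/-- Gershgorin's bound for the eigenvalues of a symmetric matrix with unit diagonal. -/
theorem abs_eigenvalues_sub_one_le {ι : Type*} [Fintype ι] [DecidableEq ι] {S : Matrix ι ι ℝ}
    (hS : S.IsHermitian) (hd : ∀ p, S p p = 1) {η : ℝ}
    (hη : ∀ p, ∑ q ∈ Finset.univ.erase p, |S p q| ≤ η) (i : ι) :
    |hS.eigenvalues i - 1| ≤ η := by
  have hv : Module.End.HasEigenvalue (Matrix.toLin' S) (hS.eigenvalues i) := by
    refine Module.End.hasEigenvalue_of_hasEigenvector (x := (hS.eigenvectorBasis i).ofLp)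
      (Module.End.hasEigenvector_iff.2 ⟨Module.End.mem_eigenspace_iff.2 ?_, ?_⟩)
    · rw [Matrix.toLin'_apply]
      simpa using hS.mulVec_eigenvectorBasis i
    · intro h
      refine hS.eigenvectorBasis.orthonormal.ne_zero i ?_
      ext j
      exact congrFun h j
  obtain ⟨k, hk⟩ := eigenvalue_mem_ball hv
  rw [Metric.mem_closedBall, Real.dist_eq, hd] at hk
  exact hk.trans (hη k)

/-! ### Row sums along the progression bounded by the tail. -/

theorem sum_comp_le_tsum_ge {ι : Type*} (F : Finset ι) {φ : ι → ℕ} (hφ : Set.InjOn φ F) {k : ℕ}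
    (hk : ∀ l ∈ F, k ≤ φ l) (e : ℕ → ℝ≥0∞) :
    ∑ l ∈ F, e (φ l) ≤ ∑' n : {n : ℕ // k ≤ n}, e n := by
  classical
  have h1 : ∑ l ∈ F, e (φ l) = ∑ n ∈ F.image φ, Set.indicator {n | k ≤ n} e n := by
    rw [Finset.sum_image hφ]
    refine Finset.sum_congr rfl fun l hl => ?_
    rw [Set.indicator_of_mem]
    exact hk l hl
  have h2 : ∑' n : {n : ℕ // k ≤ n}, e n = ∑' n, Set.indicator {n | k ≤ n} e n :=
    tsum_subtype {n | k ≤ n} e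
  rw [h1, h2]
  exact ENNReal.sum_le_tsum _

/-- On each side of `j` the map `l ↦ |j - l| k` is injective with values at least `k`; the two sides
give the factor `2`. -/
theorem sum_erase_natAbs_le (s : Finset ℕ) (j : ℕ) {k : ℕ} (hk : 0 < k) (e : ℕ → ℝ≥0∞) :
    ∑ l ∈ s.erase j, e (((j : ℤ) - l).natAbs * k) ≤ 2 * ∑' n : {n : ℕ // k ≤ n}, e n := by
  have hsub : s.erase j = ((s.erase j).filter fun l => l < j) ∪
      ((s.erase j).filter fun l => ¬ l < j) := (Finset.filter_union_filter_not_eq _ _).symm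
  rw [hsub, Finset.sum_union (Finset.disjoint_filter_filter_not _ _ _), two_mul]
  refine add_le_add (sum_comp_le_tsum_ge _ (φ := fun l : ℕ => ((j : ℤ) - l).natAbs * k) ?_ ?_ e)
    (sum_comp_le_tsum_ge _ (φ := fun l : ℕ => ((j : ℤ) - l).natAbs * k) ?_ ?_ e)
  · intro a ha b hb hab
    simp only [Finset.coe_filter, Set.mem_ofPred_eq] at ha hb
    have := Nat.eq_of_mul_eq_mul_right hk hab
    omega
  · intro l hl
    simp only [Finset.mem_filter, Finset.mem_erase] at hl
    exact Nat.le_mul_of_pos_left k (by omega)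
  · intro a ha b hb hab
    simp only [Finset.coe_filter, Set.mem_ofPred_eq] at ha hb
    have := Nat.eq_of_mul_eq_mul_right hk hab
    omega
  · intro l hl
    simp only [Finset.mem_filter, Finset.mem_erase] at hl
    exact Nat.le_mul_of_pos_left k (by omega)

theorem tsum_covAbs_le_covTail {ρ : Measure ℝ} [IsFiniteMeasure ρ] {κ κ' xs y : ℝ}
    (hκ : Integrable (fun l : ℝ => Real.exp (|l| * κ)) ρ) (hκ' : κ' < κ / 2) (hy : |y| < κ')
    (k : ℕ) :
    ∑' n : {n : ℕ // k ≤ n}, ENNReal.ofReal (covAbs ρ y (((n : ℕ) : ℝ) * xs)) ≤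
      covTail ρ κ' xs k := by
  have hy2 : 2 * |y| < κ := by linarith
  have hle (n : ℕ) : ENNReal.ofReal (covAbs ρ y ((n : ℝ) * xs)) ≤
      ‖specCov ρ ((n : ℝ) * xs : ℝ)‖ₑ + (‖deriv (modCov ρ 1 (2 * y)) ((n : ℝ) * xs)‖ₑ +
        ‖iteratedDeriv 2 (modCov ρ 2 y) ((n : ℝ) * xs)‖ₑ) := by
    rw [covAbs, ENNReal.ofReal_add (by positivity) (by positivity),
      ENNReal.ofReal_add (by positivity) (by positivity), add_assoc, ← ofReal_norm, ← ofReal_norm,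
      ← ofReal_norm]
    exact add_le_add (ENNReal.ofReal_le_ofReal (abs_covCos_le _))
      (add_le_add (ENNReal.ofReal_le_ofReal (abs_covSinh_le hκ hy2 _))
        (ENNReal.ofReal_le_ofReal (abs_covSinhSq_le hκ hy2 _)))
  refine (ENNReal.tsum_le_tsum fun n : {n : ℕ // k ≤ n} => hle n).trans ?_
  rw [ENNReal.tsum_add, ENNReal.tsum_add, covTail]
  gcongr
  exact le_iSup₂ (f := fun (y : ℝ) (_ : y ∈ Set.Ioo (-κ') κ') =>
    ((∑' j : {j : ℕ // k ≤ j}, ‖deriv (modCov ρ 1 (2 * y)) (((j : ℕ) : ℝ) * xs)‖ₑ) +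
      ∑' j : {j : ℕ // k ≤ j}, ‖iteratedDeriv 2 (modCov ρ 2 y) (((j : ℕ) : ℝ) * xs)‖ₑ))
    y (abs_lt.1 hy)

theorem covAbs_sub_mul (ρ : Measure ℝ) (y xs : ℝ) (j l k : ℕ) :
    covAbs ρ y (((j * k : ℕ) : ℝ) * xs - ((l * k : ℕ) : ℝ) * xs) =
      covAbs ρ y (((((j : ℤ) - l).natAbs * k : ℕ) : ℝ) * xs) := by
  rcases le_total l j with h | h
  · have : ((j : ℤ) - l).natAbs = j - l := by omega
    rw [this]
    congr 1
    push_cast [h]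
    ring
  · have : ((j : ℤ) - l).natAbs = l - j := by omega
    rw [this, ← covAbs_neg]
    congr 1
    push_cast [h]
    ring

/-- The off-diagonal row sums of the normalized covariance matrix are small. -/
theorem sum_abs_normCov_le {ρ : Measure ℝ} [IsFiniteMeasure ρ] {κ κ' xs y b δ : ℝ}
    (hκ : Integrable (fun l : ℝ => Real.exp (|l| * κ)) ρ) (hκ' : κ' < κ / 2) (hy : |y| < κ')
    (hb : 0 < b) (hB : b ≤ covSinhSq ρ y 0) {k : ℕ} (hk : 0 < k) (hδ0 : 0 ≤ δ)
    (hδ : covTail ρ κ' xs k ≤ ENNReal.ofReal δ) (s : Finset ℕ) (p : s × Bool) :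
    ∑ q ∈ Finset.univ.erase p, |normCov ρ y (fun j : s => ((j * k : ℕ) : ℝ) * xs) p q| ≤
      4 * (1 + κ' ^ 2 + b⁻¹ + (√b)⁻¹) * δ := by
  set t : s → ℝ := fun j : s => ((j * k : ℕ) : ℝ) * xs with ht
  set C : ℝ := 1 + κ' ^ 2 + b⁻¹ + (√b)⁻¹ with hC
  have hC0 : 0 ≤ C := by positivity
  -- Entries at the index of `p` drop out: one is the excluded diagonal entry, the other is zero.
  have h1 (q : s × Bool) : (if q = p then 0 else |normCov ρ y t p q|) ≤
      if q.1 = p.1 then 0 else C * covAbs ρ y (t p.1 - t q.1) := by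
    by_cases hq : q = p
    · simp [hq]
    · rw [if_neg hq]
      split_ifs with hq1
      · rw [normCov_same_of_ne ρ y t hq1.symm (Ne.symm hq), abs_zero]
      · exact abs_normCov_le hb hB hy.le t p q
  have h2 : ∑ q ∈ Finset.univ.erase p, |normCov ρ y t p q| ≤
      2 * C * ∑ l ∈ s.erase p.1, covAbs ρ y (((((p.1 : ℕ) : ℤ) - l).natAbs * k : ℕ) * xs) := by
    calc ∑ q ∈ Finset.univ.erase p, |normCov ρ y t p q|
        = ∑ q ∈ Finset.univ.erase p, (if q = p then 0 else |normCov ρ y t p q|) :=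
          Finset.sum_congr rfl fun q hq => (if_neg (Finset.ne_of_mem_erase hq)).symm
      _ = ∑ q, (if q = p then 0 else |normCov ρ y t p q|) := by
          rw [← Finset.sum_erase_add _ _ (Finset.mem_univ p)]
          simp
      _ ≤ ∑ q : s × Bool, (if q.1 = p.1 then 0 else C * covAbs ρ y (t p.1 - t q.1)) :=
          Finset.sum_le_sum fun q _ => h1 q
      _ = 2 * C * ∑ l : s, (if l = p.1 then 0 else covAbs ρ y (t p.1 - t l)) := by
          rw [Fintype.sum_prod_type, Finset.mul_sum]
          refine Finset.sum_congr rfl fun l _ => ?_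
          simp only [Fintype.sum_bool]
          split_ifs <;> ring
      _ = 2 * C * ∑ l ∈ s, (if l = (p.1 : ℕ) then 0
            else covAbs ρ y (((((p.1 : ℕ) : ℤ) - l).natAbs * k : ℕ) * xs)) := by
          rw [← Finset.sum_coe_sort s]
          congr 1
          refine Finset.sum_congr rfl fun l _ => ?_
          simp only [ht, covAbs_sub_mul, Subtype.ext_iff]
      _ = _ := by
          rw [← Finset.sum_erase_add _ _ p.1.2, if_pos rfl, add_zero]
          congr 1
          exact Finset.sum_congr rfl fun l hl => if_neg (Finset.ne_of_mem_erase hl)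
  have h3 : ∑ l ∈ s.erase p.1, covAbs ρ y (((((p.1 : ℕ) : ℤ) - l).natAbs * k : ℕ) * xs) ≤
      2 * δ := by
    rw [← ENNReal.ofReal_le_ofReal_iff (by positivity),
      ENNReal.ofReal_sum_of_nonneg fun _ _ => covAbs_nonneg _ _ _]
    refine (sum_erase_natAbs_le s p.1 hk
      fun n => ENNReal.ofReal (covAbs ρ y ((n : ℝ) * xs))).trans ?_
    rw [ENNReal.ofReal_mul zero_le_two, ENNReal.ofReal_ofNat]
    gcongr
    exact (tsum_covAbs_le_covTail hκ hκ' hy k).trans hδ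
  -- One `2` counts the two parts at each index, the other the two sides of `p`.
  calc _ ≤ 2 * C * (2 * δ) := h2.trans (mul_le_mul_of_nonneg_left h3 (by positivity))
    _ = _ := by ring

/-! ### Covariances of the real and imaginary parts -/

section

variable {Ω : Type*} [MeasurableSpace Ω] {P : Measure Ω} {ρ : Measure ℝ} {κ y : ℝ}
  {f : ℂ → Ω → ℂ} {J : Type*}

theorem add_I_mul_mem_strip (hy : 2 * |y| < κ) (t : ℝ) :
    (t : ℂ) + Complex.I * (y : ℂ) ∈ strip (κ / 2) := by
  simp only [strip, Set.mem_ofPred_eq, Complex.add_im, Complex.ofReal_im, Complex.mul_im,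
    Complex.I_re, Complex.I_im, Complex.ofReal_re]
  ring_nf
  linarith

theorem hasGaussianLaw_realParts [Fintype J] (hf : IsGaussianExtension P ρ κ f) (hy : 2 * |y| < κ)
    (t : J → ℝ) :
    HasGaussianLaw (fun ω p => realParts (fun j ω => f ((t j : ℂ) + Complex.I * (y : ℂ)) ω) p ω)
      P := by
  classical
  let z : J → strip (κ / 2) := fun j =>
    ⟨(t j : ℂ) + Complex.I * (y : ℂ), add_I_mul_mem_strip hy (t j)⟩
  -- Distinct `j` may give the same point, so the joint law is taken on the image and pulled back by
  -- `L`.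
  let I : Finset (strip (κ / 2)) := Finset.univ.image z
  have hz (j : J) : z j ∈ I := Finset.mem_image_of_mem z (Finset.mem_univ j)
  let L : (I → ℂ) →L[ℝ] (J × Bool → ℝ) := ContinuousLinearMap.pi fun p =>
    (if p.2 then Complex.reCLM else Complex.imCLM).comp
      (ContinuousLinearMap.proj (R := ℝ) (φ := fun _ : I => ℂ) ⟨z p.1, hz p.1⟩)
  have h := (hf.gaussian.hasGaussianLaw I).map_fun L
  refine h.congr (ae_of_all _ fun ω => ?_)
  funext p
  rcases p with ⟨j, _ | _⟩ <;> simp [L, realParts, z]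

theorem memLp_two_of_mem_strip (hf : IsGaussianExtension P ρ κ f) {z : ℂ}
    (hz : z ∈ strip (κ / 2)) : MemLp (f z) 2 P := by
  classical
  have h := (hf.gaussian.hasGaussianLaw {⟨z, hz⟩}).map_fun
    (ContinuousLinearMap.proj (R := ℝ) (φ := fun _ : ({⟨z, hz⟩} : Finset (strip (κ / 2))) => ℂ)
      ⟨⟨z, hz⟩, Finset.mem_singleton_self _⟩)
  exact h.memLp_two

theorem integral_realParts [IsFiniteMeasure P] (hf : IsGaussianExtension P ρ κ f)
    (hy : 2 * |y| < κ) (t : J → ℝ) (p : J × Bool) :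
    ∫ ω, realParts (fun j ω => f ((t j : ℂ) + Complex.I * (y : ℂ)) ω) p ω ∂P = 0 := by
  have hz := add_I_mul_mem_strip hy (t p.1)
  have hint := (memLp_two_of_mem_strip hf hz).integrable one_le_two
  have hm := hf.mean _ hz
  rcases p with ⟨j, _ | _⟩
  · have h := Complex.imCLM.integral_comp_comm hint
    rw [hm, map_zero] at h
    exact h
  · have h := Complex.reCLM.integral_comp_comm hint
    rw [hm, map_zero] at h
    exact h

/-- By polarization, products of real and imaginary parts are half sums or differences of parts of
`f(z) conj(f(w))` and `f(z) f(w)`, with expectations `r(x + 2iy)` and `r(x)`. -/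
theorem integral_realParts_mul [IsProbabilityMeasure ρ] [ρ.IsNegInvariant]
    (hf : IsGaussianExtension P ρ κ f) (hκ : Integrable (fun l : ℝ => Real.exp (|l| * κ)) ρ)
    (hy : 2 * |y| < κ) (hB : 0 < covSinhSq ρ y 0) (t : J → ℝ) (p q : J × Bool) :
    ∫ ω, realParts (fun j ω => f ((t j : ℂ) + Complex.I * (y : ℂ)) ω) p ω *
        realParts (fun j ω => f ((t j : ℂ) + Complex.I * (y : ℂ)) ω) q ω ∂P =
      (if p.2 then √(1 + y ^ 2 * covSinhSq ρ y 0) else y * √(covSinhSq ρ y 0)) *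
        normCov ρ y t p q *
        (if q.2 then √(1 + y ^ 2 * covSinhSq ρ y 0) else y * √(covSinhSq ρ y 0)) := by
  have hκ0 : 2 * |(0 : ℝ)| < κ := by
    rw [abs_zero, mul_zero]; linarith [abs_nonneg y]
  have key (a b : ℝ) : ∀ z w : ℂ, z = (a : ℂ) + Complex.I * (y : ℂ) →
      w = (b : ℂ) + Complex.I * (y : ℂ) →
      ∫ ω, (f z ω).re * (f w ω).re ∂P = covCos ρ (a - b) + y ^ 2 * covSinhSq ρ y (a - b) ∧
      ∫ ω, (f z ω).im * (f w ω).im ∂P = y ^ 2 * covSinhSq ρ y (a - b) ∧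
      ∫ ω, (f z ω).re * (f w ω).im ∂P = y * covSinh ρ y (a - b) := by
    rintro z w rfl rfl
    have hz := add_I_mul_mem_strip hy a
    have hw := add_I_mul_mem_strip hy b
    have hc := hf.cov _ hz _ hw
    have hp := hf.pseudoCov _ hz _ hw
    set z : ℂ := (a : ℂ) + Complex.I * (y : ℂ) with hzdef
    set w : ℂ := (b : ℂ) + Complex.I * (y : ℂ) with hwdef
    have hLz := memLp_two_of_mem_strip hf hz
    have hLw := memLp_two_of_mem_strip hf hw
    have hi1 : Integrable (fun ω => f z ω * starRingEnd ℂ (f w ω)) P :=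
      hLz.integrable_mul hLw.star
    have hi2 : Integrable (fun ω => f z ω * f w ω) P := hLz.integrable_mul hLw
    have e1 : z - starRingEnd ℂ w = ⟨a - b, 2 * y⟩ := by
      apply Complex.ext
      · simp [hzdef, hwdef]
      · simp [hzdef, hwdef]
        ring
    -- Writing `0` as `2 * 0` makes the pseudo-covariance the case `y = 0` of the same formulas.
    have e2 : z - w = ⟨a - b, 2 * 0⟩ := by
      apply Complex.ext <;> simp [hzdef, hwdef]
    rw [e1] at hc
    rw [e2] at hp
    have c1 := congrArg Complex.re hc
    have c2 := congrArg Complex.im hc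
    have p1 := congrArg Complex.re hp
    have p2 := congrArg Complex.im hp
    rw [re_specCov hκ hy] at c1
    rw [im_specCov hκ hy] at c2
    rw [show ((2 : ℝ) * 0) = 2 * (0 : ℝ) from rfl, re_specCov hκ hκ0] at p1
    rw [im_specCov hκ hκ0] at p2
    rw [← Complex.reCLM_apply, ← Complex.reCLM.integral_comp_comm hi1] at c1
    rw [← Complex.imCLM_apply, ← Complex.imCLM.integral_comp_comm hi1] at c2
    rw [← Complex.reCLM_apply, ← Complex.reCLM.integral_comp_comm hi2] at p1
    rw [← Complex.imCLM_apply, ← Complex.imCLM.integral_comp_comm hi2] at p2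
    have r1 := Complex.reCLM.integrable_comp hi1
    have r2 := Complex.imCLM.integrable_comp hi1
    have r3 := Complex.reCLM.integrable_comp hi2
    have r4 := Complex.imCLM.integrable_comp hi2
    refine ⟨?_, ?_, ?_⟩
    · have h := integral_add r1 r3
      have h' : ∫ ω, (f z ω).re * (f w ω).re ∂P = ∫ ω, (Complex.reCLM (f z ω * starRingEnd ℂ (f w ω)) + Complex.reCLM (f z ω * f w ω)) / 2 ∂P := by
        congr 1; funext ω; simp
      rw [h', integral_div, h]
      rw [c1, p1]; ring
    · have h := integral_sub r1 r3
      have h' : ∫ ω, (f z ω).im * (f w ω).im ∂P = ∫ ω, (Complex.reCLM (f z ω * starRingEnd ℂ (f w ω)) - Complex.reCLM (f z ω * f w ω)) / 2 ∂P := by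
        congr 1; funext ω; simp
      rw [h', integral_div, h]
      rw [c1, p1]; ring
    · have h := integral_sub r4 r2
      have h' : ∫ ω, (f z ω).re * (f w ω).im ∂P = ∫ ω, (Complex.imCLM (f z ω * f w ω) - Complex.imCLM (f z ω * starRingEnd ℂ (f w ω))) / 2 ∂P := by
        congr 1; funext ω; simp
      rw [h', integral_div, h]
      rw [c2, p2]; ring
  have hA : 0 < 1 + y ^ 2 * covSinhSq ρ y 0 := by positivity
  have hsA : 0 < √(1 + y ^ 2 * covSinhSq ρ y 0) := Real.sqrt_pos.2 hA
  have hsB : 0 < √(covSinhSq ρ y 0) := Real.sqrt_pos.2 hB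
  have hsA2 := Real.mul_self_sqrt hA.le
  have hsB2 := Real.mul_self_sqrt hB.le
  rcases p with ⟨j, _ | _⟩ <;> rcases q with ⟨l, _ | _⟩ <;>
    simp only [normCov, realParts, Bool.false_eq_true, if_true, if_false]
  · rw [(key (t j) (t l) _ _ rfl rfl).2.1]
    field_simp
    linear_combination -(y ^ 2 * covSinhSq ρ y (t j - t l)) * hsB2
  · simp only [mul_comm (f _ _).im]
    rw [(key (t l) (t j) _ _ rfl rfl).2.2]
    field_simp
  · rw [(key (t j) (t l) _ _ rfl rfl).2.2]
    field_simp
  · rw [(key (t j) (t l) _ _ rfl rfl).1]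
    field_simp
    linear_combination -(covCos ρ (t j - t l) + y ^ 2 * covSinhSq ρ y (t j - t l)) * hsA2

end

/-! ### Decorrelation of the product moments -/

theorem normCov_unit {ρ : Measure ℝ} [IsProbabilityMeasure ρ] {y : ℝ}
    (hB : 0 < covSinhSq ρ y 0) (t : Unit → ℝ) : normCov ρ y t = 1 := by
  ext p q
  by_cases h : p = q
  · rw [h, normCov_diag hB, Matrix.one_apply_eq]
  · rw [normCov_same_of_ne ρ y t (Subsingleton.elim _ _) h, Matrix.one_apply_ne h]

section

variable {Ω : Type*} [MeasurableSpace Ω] {P : Measure Ω} [IsProbabilityMeasure P] {ρ : Measure ℝ}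
  [IsProbabilityMeasure ρ] [ρ.IsNegInvariant] {κ y : ℝ} {f : ℂ → Ω → ℂ}

theorem baseMoment_eq_ellipticMoment (hf : IsGaussianExtension P ρ κ f)
    (hκ : Integrable (fun l : ℝ => Real.exp (|l| * κ)) ρ) (hy : 2 * |y| < κ)
    (hB : 0 < covSinhSq ρ y 0) (xs s : ℝ) :
    baseMoment P f xs y s = ellipticMoment (√(1 + y ^ 2 * covSinhSq ρ y 0))
      (y * √(covSinhSq ρ y 0)) s := by
  rw [← lintegral_enorm_rpow_eq_ellipticMoment
    (hasGaussianLaw_realParts (J := Unit) hf hy fun _ => 0)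
    (integral_realParts hf hy fun _ => 0) _ _
    (fun p q => by rw [integral_realParts_mul hf hκ hy hB, normCov_unit hB]) s]
  simp [baseMoment, gaussSample]

/-- If the covariances at distance at least `k` are summably small, the product moments are those of
independent variables up to an exponential factor close to one. -/
theorem prodMoment_le_of_covTail_le {κ' xs b η : ℝ} (hf : IsGaussianExtension P ρ κ f)
    (hκ : Integrable (fun l : ℝ => Real.exp (|l| * κ)) ρ) (hκ' : κ' < κ / 2) (hy : |y| < κ')
    (hb : 0 < b) (hB : b ≤ covSinhSq ρ y 0) (hη0 : 0 ≤ η) (hη1 : η < 1) {k : ℕ} (hk : 0 < k)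
    (hδ : covTail ρ κ' xs k ≤ ENNReal.ofReal (η / (4 * (1 + κ' ^ 2 + b⁻¹ + (√b)⁻¹)))) (m : ℕ)
    {s : ℝ} (hs : s ≤ 2) :
    prodMoment P f xs k m y s ≤
      (ENNReal.ofReal ((1 + η) ^ 2 / (1 - η)) * baseMoment P f xs y s) ^ m := by
  have hy2 : 2 * |y| < κ := by linarith
  have hB0 := hb.trans_le hB
  set C : ℝ := 1 + κ' ^ 2 + b⁻¹ + (√b)⁻¹ with hC
  have hC0 : 0 < C := by positivity
  set t : Finset.Icc 1 m → ℝ := fun j => ((j * k : ℕ) : ℝ) * xs with ht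
  have heig := abs_eigenvalues_sub_one_le (isHermitian_normCov ρ y t) (normCov_diag hB0 t)
    (sum_abs_normCov_le hκ hκ' hy hb hB hk (by positivity) hδ (Finset.Icc 1 m))
  -- The tail bound is calibrated so that the Gershgorin radius is exactly `η`.
  have h4 : 4 * C * (η / (4 * C)) = η := by field_simp
  rw [← hC, h4] at heig
  have hu : ((1 - η).toNNReal : ℝ) = 1 - η := Real.coe_toNNReal _ (by linarith)
  have hw : ((1 + η).toNNReal : ℝ) = 1 + η := Real.coe_toNNReal _ (by linarith)
  have h := lintegral_prod_enorm_rpow_le (hasGaussianLaw_realParts hf hy2 t)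
    (integral_realParts hf hy2 t) (isHermitian_normCov ρ y t) _ _
    (integral_realParts_mul hf hκ hy2 hB0 t)
    (u := (1 - η).toNNReal) (w := (1 + η).toNNReal) (Real.toNNReal_pos.2 (by linarith))
    (Real.one_le_toNNReal.2 (by linarith))
    (fun i => by rw [hu]; linarith [(abs_le.1 (heig i)).1])
    (fun i => by rw [hw]; linarith [(abs_le.1 (heig i)).2]) hs
  rw [← baseMoment_eq_ellipticMoment hf hκ hy2 hB0 xs] at h
  have hcard : Fintype.card (Finset.Icc 1 m) = m := by simp
  have hconst : (((1 + η).toNNReal / (1 - η).toNNReal * (1 + η).toNNReal : NNReal) : ℝ≥0∞) =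
      ENNReal.ofReal ((1 + η) ^ 2 / (1 - η)) := by
    rw [← ENNReal.ofReal_coe_nnreal]
    congr 1
    push_cast
    rw [hu, hw]
    ring
  rw [hcard, hconst] at h
  refine le_trans (le_of_eq ?_) h
  rw [prodMoment]
  refine lintegral_congr fun ω => ?_
  rw [← Finset.prod_coe_sort]
  refine Finset.prod_congr rfl fun j _ => ?_
  simp [gaussSample, ht]

/-- Lyapunov's inequality for the moments of `G_0`. -/
theorem baseMoment_le_rpow_half (hf : IsGaussianExtension P ρ κ f)
    (hκ : Integrable (fun l : ℝ => Real.exp (|l| * κ)) ρ) (hy : 2 * |y| < κ)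
    (hB : 0 < covSinhSq ρ y 0) (xs s : ℝ) :
    baseMoment P f xs y s ≤ baseMoment P f xs y (2 * s) ^ (1 / 2 : ℝ) := by
  rw [baseMoment_eq_ellipticMoment hf hκ hy hB, baseMoment_eq_ellipticMoment hf hκ hy hB]
  exact ellipticMoment_le_rpow_half _ _ _

end

theorem propositionp {Ω : Type*} [MeasurableSpace Ω] (P : Measure Ω) [IsProbabilityMeasure P]
    (ρ : Measure ℝ) [IsProbabilityMeasure ρ] [ρ.IsNegInvariant] (κ κ' xs : ℝ)
    (hρ : SpectralRegularity ρ κ κ' xs)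
    (f : ℂ → Ω → ℂ) (hf : IsGaussianExtension P ρ κ f) :
    ∀ ζ : ℝ, 0 < ζ → ∃ εs : ℝ, 0 < εs ∧ ∀ ε : ℝ, 0 < ε → ε ≤ εs →
      ∃ ks : ℕ, ∀ k : ℕ, ks ≤ k → ∃ ms : ℕ, ∀ m : ℕ, ms ≤ m → ∀ y : ℝ, |y| < κ' →
        (baseMoment P f xs y (2 * ε) < ∞ ∧
          prodMoment P f xs k m y ε ≤
            ENNReal.ofReal (Real.exp (2 * ε * ζ * m)) *
              baseMoment P f xs y (2 * ε) ^ ((m : ℝ) / 2)) ∧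
        (baseMoment P f xs y (-(2 * ε)) < ∞ ∧
          prodMoment P f xs k m y (-ε) ≤
            ENNReal.ofReal (Real.exp (2 * ε * ζ * m)) *
              baseMoment P f xs y (-(2 * ε)) ^ ((m : ℝ) / 2)) := by
  intro ζ hζ
  -- With `ε ≤ 1/4`, the order `2ε ≤ 1/2` is below the threshold `1` for negative moments; no
  -- dependence on `ζ` arises.
  refine ⟨1 / 4, by norm_num, fun ε hε hε4 => ?_⟩
  have hκ := hρ.expMoment
  set b : ℝ := ∫ l, l ^ 2 ∂ρ with hbdef
  have hb : 0 < b := integral_sq_pos hκ hρ.kappa_pos (hρ.noAtoms 0)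
  set E : ℝ := Real.exp (2 * ε * ζ) with hE
  have hE1 : 1 < E := Real.one_lt_exp_iff.2 (by positivity)
  -- This `η` solves `1 + 3η = E(1 - η)`, and `(1 + η)² ≤ 1 + 3η` because `η < 1`.
  set η : ℝ := (E - 1) / (E + 3) with hη
  have hη0 : 0 < η := div_pos (by linarith) (by linarith)
  have hη1 : η < 1 := (div_lt_one (by linarith)).2 (by linarith)
  have hηE : η * (E + 3) = E - 1 := div_mul_cancel₀ _ (by linarith)
  have hfactor : (1 + η) ^ 2 / (1 - η) ≤ E := by
    rw [div_le_iff₀ (by linarith)]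
    nlinarith
  have hδ : 0 < η / (4 * (1 + κ' ^ 2 + b⁻¹ + (√b)⁻¹)) := by positivity
  obtain ⟨k₀, hk₀⟩ := eventually_atTop.1
    (hρ.tail_tendsto.eventually (eventually_le_nhds (ENNReal.ofReal_pos.2 hδ)))
  -- The `+ 1` keeps `k` positive, so distinct `j` give distinct `jk`. The bound holds for every
  -- `m`, hence the threshold `0`.
  refine ⟨k₀ + 1, fun k hk => ⟨0, fun m _ y hy => ?_⟩⟩
  have hy2 : 2 * |y| < κ := by linarith [hρ.kappa'_lt]
  have hB : b ≤ covSinhSq ρ y 0 := integral_sq_le_covSinhSq_zero hκ hy2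
  have hB0 := hb.trans_le hB
  have hα : √(1 + y ^ 2 * covSinhSq ρ y 0) ≠ 0 := (Real.sqrt_pos.2 (by positivity)).ne'
  -- The condition `s ≤ 2` admits both `s = ε` and `s = -ε`.
  have hmain (s : ℝ) (hs : s ≤ 2) : prodMoment P f xs k m y s ≤
      ENNReal.ofReal (Real.exp (2 * ε * ζ * m)) * baseMoment P f xs y (2 * s) ^ ((m : ℝ) / 2) := by
    refine (prodMoment_le_of_covTail_le hf hκ hρ.kappa'_lt hy hb hB hη0.le hη1 (by omega)
      (hk₀ k (by omega)) m hs).trans ?_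
    rw [mul_pow]
    refine mul_le_mul' ?_ ?_
    · rw [mul_comm (2 * ε * ζ), Real.exp_nat_mul, ENNReal.ofReal_pow (Real.exp_pos _).le]
      exact pow_le_pow_left' (ENNReal.ofReal_le_ofReal hfactor) m
    · rw [show (m : ℝ) / 2 = 1 / 2 * m by ring, ENNReal.rpow_mul, ENNReal.rpow_natCast]
      exact pow_le_pow_left' (baseMoment_le_rpow_half hf hκ hy2 hB0 xs s) m
  refine ⟨⟨?_, hmain ε (by linarith)⟩, ?_, ?_⟩
  · rw [baseMoment_eq_ellipticMoment hf hκ hy2 hB0]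
    exact ellipticMoment_lt_top_of_nonneg _ _ (by positivity) (by linarith)
  · rw [baseMoment_eq_ellipticMoment hf hκ hy2 hB0]
    exact ellipticMoment_lt_top_of_neg _ hα (by positivity) (by linarith)
  · have h := hmain (-ε) (by linarith)
    rwa [mul_neg] at h
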